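/- Let $c_f,c_g>0$ and $k\neq 0$ be real, and put $f(y)=\frac{1}{2c_f}y^2$, $g(x)=\frac{1}{2c_g}x^2$, $h(x)=f(kx)+g(x)$ for $x,y\in\mathbb R$. Let $\mu^\ast$ be the probability measure on $\mathbb R$ with Lebesgue density proportional to $e^{-h}$. Then $h(x)=\frac{k^2c_g+c_f}{2c_fc_g}x^2$, and the convex conjugate $f^\ast(y)=\sup_x\{xy-f(x)\}$ is $f^\ast(y)=\frac{c_f}{2}y^2$. For $\lambda>0$ consider the primal-dual diffusion for $Z_t=(X_t,Y_t)\in\mathbb R^2$, $$\mathrm dX_t\in-(\partial g(X_t)+kY_t)\,\mathrm dt+\sqrt2\,\mathrm dW_t,\qquad \mathrm dY_t\in-\lambda(\partial f^\ast(Y_t)-kX_t)\,\mathrm dt,$$ where $W$ is a one-dimensional Brownian motion independent of $Z_0$ and $Z$ has almost surely continuous paths. It is equivalent to the linear equation $$\mathrm dZ_t=-AZ_t\,\mathrm dt+B\,\mathrm dW_t,\qquad A=\begin{pmatrix}c_g^{-1}&k\\-\lambda k&\lambda c_f\end{pmatrix},\quad B=\begin{pmatrix}\sqrt2\\0\end{pmatrix}.$$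 For every solution $Z$, with $\pi_t$ the law of $Z_t$, the following hold. (i) Whatever the (possibly singular) initial law $\pi_0$ is, for every $t>0$ the law $\pi_t$ has a $C^\infty$ density with respect to Lebesgue measure on $\mathbb R^2$. (ii) If $\pi_0$ is Gaussian (possibly degenerate, i.e. with singular covariance matrix), then $\pi_t$ is a non-degenerate Gaussian for every $t>0$, and as $t\to\infty$ it converges, weakly and in the 2-Wasserstein distance, to the Gaussian $\pi_\lambda$ with mean zero and positive definite covariance matrix $$\frac{1}{(c_f+k^2c_g)(1+\lambda c_fc_g)}\begin{pmatrix}c_g(c_f+k^2c_g)+\lambda c_f^2c_g^2&k\lambda c_fc_g^2\\k\lambda c_fc_g^2&k^2\lambda c_g^2\end{pmatrix}.$$ The law $\pi_\lambda$ is the unique stationary law of the diffusion: a solution satisfies $\pi_t=\pi_0$ for all $t\ge0$ if and only if $\pi_0=\pi_\lambda$. The $x$-marginal of $\pi_\lambda$ is not equal to $\mu^\ast$. Finally, as $\lambda\to\infty$, $\pi_\lambda$ converges, weakly and in the 2-Wasserstein distance, to the push-forward $(\mathrm{id},f'(k\,\cdot))_{\#}\mu^\ast$ of $\mu^\ast$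 under $x\mapsto(x,f'(kx))$. This is a degenerate Gaussian with mean zero (its covariance matrix is singular), and its $x$-marginal is $\mu^\ast$. -/

import Mathlib

open MeasureTheory ProbabilityTheory Filter Topology
open scoped NNReal ENNReal Matrix BoundedContinuousFunction

noncomputable section

namespace PrimalDual

/-- The plane of joint primal-dual variables `z = (x, y)`, with its Euclidean norm and Lebesgue
measure; `z 0` is the primal variable `x`, `z 1` the dual variable `y`. -/
abbrev Plane : Type := EuclideanSpace ℝ (Fin 2)

/-! ### Convex analysis on the line -/

/-- The convex conjugate `f* y = sup_x (x y - f x)`. -/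
def convexConjugate (f : ℝ → EReal) (y : ℝ) : EReal :=
  ⨆ x : ℝ, ((x * y : ℝ) : EReal) - f x

/-- The convex subdifferential of a proper function `φ` at `x`. -/
def subdifferential (φ : ℝ → EReal) (x : ℝ) : Set ℝ :=
  {p | ∀ z : ℝ, φ x + ((p * (z - x) : ℝ) : EReal) ≤ φ z}

/-- The quadratic potential `x ↦ x² / (2 c)`. -/
def quadPotential (c : ℝ) (x : ℝ) : ℝ := 1 / (2 * c) * x ^ 2

/-- The full potential `h x = f (k x) + g x`. -/
def fullPotential (f g : ℝ → ℝ) (k : ℝ) (x : ℝ) : ℝ := f (k * x) + g x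

/-- The target distribution, with Lebesgue density `exp (-h x) / ∫ exp (-h w) dw`. -/
def target (f g : ℝ → ℝ) (k : ℝ) : Measure ℝ :=
  volume.tilted fun x => -fullPotential f g k x

/-! ### Diffusions with additive noise -/

section Diffusion

variable {Ω : Type*} [MeasurableSpace Ω]

/-- A process `Z` in the plane with almost surely continuous paths, together with a
one-dimensional Brownian motion `W` that is independent of the initial value `Z 0`. -/
structure IsNoisyPair (P : Measure Ω) (W : ℝ≥0 → Ω → ℝ) (Z : ℝ≥0 → Ω → Plane) : Prop where
  brownian : IsBrownianReal W P
  aemeasurable : ∀ t, AEMeasurable (Z t) P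
  indep : IndepFun (Z 0) (fun ω t => W t ω) P
  continuous : ∀ᵐ ω ∂P, Continuous fun t => Z t ω

/-- `Z = (X, Y)` solves the primal-dual diffusion inclusion with potentials `f`, `g`, operator `k`
and weight `lam`,
`dX ∈ -(∂g(X) + k Y) dt + √2 dW`, `dY ∈ -lam (∂f*(Y) - k X) dt`,
in integrated form: `p`, `q` are the selections of the subdifferentials along the path. The noise
is additive, so that its stochastic integral is `√2 W`. -/
structure SolvesPrimalDual (f g : ℝ → EReal) (k lam : ℝ) (P : Measure Ω) (W : ℝ≥0 → Ω → ℝ)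
    (Z : ℝ≥0 → Ω → Plane) : Prop extends IsNoisyPair P W Z where
  equation : ∀ᵐ ω ∂P, ∃ p q : ℝ → ℝ,
    (∀ t : ℝ≥0, IntervalIntegrable p volume 0 t ∧ IntervalIntegrable q volume 0 t) ∧
    (∀ᵐ s ∂volume.restrict (Set.Ici (0 : ℝ)),
      p s ∈ subdifferential g (Z s.toNNReal ω 0) ∧
      q s ∈ subdifferential (convexConjugate f) (Z s.toNNReal ω 1)) ∧
    ∀ t : ℝ≥0,
      Z t ω 0 = Z 0 ω 0 - (∫ s in (0 : ℝ)..t, (p s + k * Z s.toNNReal ω 1)) + √2 * W t ω ∧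
      Z t ω 1 = Z 0 ω 1 - ∫ s in (0 : ℝ)..t, lam * (q s - k * Z s.toNNReal ω 0)

/-- `Z` solves the linear stochastic differential equation `dZ = -A Z dt + B dW`, in integrated
form and by coordinates. -/
structure SolvesLinear (A : Matrix (Fin 2) (Fin 2) ℝ) (B : Fin 2 → ℝ) (P : Measure Ω)
    (W : ℝ≥0 → Ω → ℝ) (Z : ℝ≥0 → Ω → Plane) : Prop extends IsNoisyPair P W Z where
  equation : ∀ᵐ ω ∂P, ∀ (t : ℝ≥0) (i : Fin 2),
    Z t ω i = Z 0 ω i - (∫ s in (0 : ℝ)..t, (A *ᵥ (Z s.toNNReal ω).ofLp) i) + B i * W t ω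

end Diffusion

/-- The drift matrix of the quadratic example. -/
def driftMatrix (cf cg k lam : ℝ) : Matrix (Fin 2) (Fin 2) ℝ :=
  !![cg⁻¹, k; -lam * k, lam * cf]

/-- The diffusion coefficient, a column vector. -/
def diffusionVector : Fin 2 → ℝ := ![√2, 0]

/-! ### Convergence of measures -/

/-- Weak convergence of measures on the plane, tested with bounded continuous functions. -/
def TendstoWeakly {ι : Type*} (μ : ι → Measure Plane) (l : Filter ι) (ν : Measure Plane) : Prop :=
  ∀ φ : Plane →ᵇ ℝ, Tendsto (fun i => ∫ z, φ z ∂μ i) l (𝓝 (∫ z, φ z ∂ν))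

/-- The 2-Wasserstein distance: the infimum over all couplings. -/
def wasserstein (μ ν : Measure Plane) : ℝ≥0∞ :=
  (⨅ γ ∈ {γ : Measure (Plane × Plane) | γ.fst = μ ∧ γ.snd = ν},
    ∫⁻ p, edist p.1 p.2 ^ 2 ∂γ) ^ (1 / 2 : ℝ)

/-! ### The explicit Gaussian limits -/

/-- The covariance matrix of the stationary distribution. -/
def stationaryCov (cf cg k lam : ℝ) : Matrix (Fin 2) (Fin 2) ℝ :=
  (1 / ((cf + k ^ 2 * cg) * (1 + lam * cf * cg))) •
    !![cg * (cf + k ^ 2 * cg) + lam * cf ^ 2 * cg ^ 2, k * lam * cf * cg ^ 2;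
       k * lam * cf * cg ^ 2, k ^ 2 * lam * cg ^ 2]

/-- The centred Gaussian with that covariance matrix. -/
def stationaryLaw (cf cg k lam : ℝ) : Measure Plane :=
  multivariateGaussian 0 (stationaryCov cf cg k lam)

/-- The push-forward of the target distribution under `x ↦ (x, f' (k x))`. -/
def liftedTarget (f g : ℝ → ℝ) (k : ℝ) : Measure Plane :=
  (target f g k).map fun x => !₂[x, deriv f (k * x)]

end PrimalDual

end

namespace PrimalDual

/-- Riemann–Stieltjes sums against a primitive of `h` converge to `∫ f h`. -/
lemma tendsto_sum_mul_integral {f h : ℝ → ℝ} (hf : Continuous f) (hh : Continuous h) {t : ℝ}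
    (ht : 0 ≤ t) (τ : ℕ → ℕ → ℝ)
    (hτ : ∀ n i : ℕ, τ n i ∈ Set.Icc (i * (t / n)) ((i + 1 : ℕ) * (t / n))) :
    Tendsto (fun n : ℕ => ∑ i ∈ Finset.range n,
      f (τ n i) * ∫ s in (i * (t / n))..((i + 1 : ℕ) * (t / n)), h s) atTop
      (𝓝 (∫ s in (0 : ℝ)..t, f s * h s)) := by
  obtain ⟨C, hC⟩ := isCompact_Icc.exists_bound_of_continuousOn (hh.continuousOn (s := Set.Icc 0 t))
  have hC0 : 0 ≤ C := (norm_nonneg _).trans (hC 0 (by simp [ht]))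
  rw [Metric.tendsto_atTop]
  intro ε hε
  have huc := isCompact_Icc.uniformContinuousOn_of_continuous
    (hf.continuousOn (s := Set.Icc 0 t))
  rw [Metric.uniformContinuousOn_iff] at huc
  set e := ε / (2 * (C * t + 1)) with he
  have hCt : 0 ≤ C * t := mul_nonneg hC0 ht
  have hepos : 0 < e := by positivity
  obtain ⟨δ, hδ, H⟩ := huc e hepos
  obtain ⟨N, hN⟩ := exists_nat_gt (t / δ)
  refine ⟨N + 1, fun n hn => ?_⟩
  have hn0 : (0 : ℝ) < n := by exact_mod_cast (by omega : 0 < n)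
  have hstep : t / n < δ := by
    rw [div_lt_iff₀ hn0]
    rw [div_lt_iff₀ hδ] at hN
    have : (N : ℝ) ≤ n := by exact_mod_cast (by omega : N ≤ n)
    nlinarith
  have hstep0 : 0 ≤ t / n := by positivity
  have hsplit : ∫ s in (0 : ℝ)..t, f s * h s =
      ∑ i ∈ Finset.range n, ∫ s in (i * (t / n))..((i + 1 : ℕ) * (t / n)), f s * h s := by
    have := intervalIntegral.sum_integral_adjacent_intervals (μ := volume)
      (f := fun s => f s * h s) (a := fun i : ℕ => (i : ℝ) * (t / n)) (n := n)
      (fun k _ => (hf.mul hh).intervalIntegrable _ _)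
    rw [this]
    congr 1
    · simp
    · field_simp
  rw [hsplit, Real.dist_eq, ← Finset.sum_sub_distrib]
  have hterm : ∀ i ∈ Finset.range n,
      |f (τ n i) * (∫ s in (i * (t / n))..((i + 1 : ℕ) * (t / n)), h s) -
        ∫ s in (i * (t / n))..((i + 1 : ℕ) * (t / n)), f s * h s| ≤ e * C * (t / n) := by
    intro i hi
    have hi' : (i + 1 : ℕ) ≤ n := by simpa using hi
    have hle : (i : ℝ) * (t / n) ≤ (i + 1 : ℕ) * (t / n) := by
      push_cast; nlinarith
    have htop : ((i + 1 : ℕ) : ℝ) * (t / n) ≤ t := by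
      calc ((i + 1 : ℕ) : ℝ) * (t / n) ≤ n * (t / n) := by gcongr
        _ = t := by field_simp
    have hbot : 0 ≤ (i : ℝ) * (t / n) := by positivity
    have hi1 : IntervalIntegrable (fun s => f (τ n i) * h s) volume (i * (t / n))
        ((i + 1 : ℕ) * (t / n)) := (hh.const_mul _).intervalIntegrable _ _
    have hi2 : IntervalIntegrable (fun s => f s * h s) volume (i * (t / n))
        ((i + 1 : ℕ) * (t / n)) := (hf.mul hh).intervalIntegrable _ _
    rw [← intervalIntegral.integral_const_mul, ← intervalIntegral.integral_sub hi1 hi2]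
    have := intervalIntegral.norm_integral_le_of_norm_le_const (a := (i : ℝ) * (t / n))
      (b := (i + 1 : ℕ) * (t / n)) (C := e * C) (f := fun s => f (τ n i) * h s - f s * h s) ?_
    · refine (Real.norm_eq_abs _ ▸ this).trans_eq ?_
      rw [abs_of_nonneg (by linarith)]
      push_cast; ring
    · intro s hs
      rw [Set.uIoc_of_le hle] at hs
      have hs' : s ∈ Set.Icc 0 t := ⟨hbot.trans hs.1.le, hs.2.trans htop⟩
      have hτ' := hτ n i
      have hfs : |f (τ n i) - f s| ≤ e := by
        refine (H _ ⟨hbot.trans hτ'.1, hτ'.2.trans htop⟩ _ hs' ?_).le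
        refine lt_of_le_of_lt ?_ hstep
        rw [Real.dist_eq, abs_le]
        have h1 := hs.1; have h2 := hs.2; have h3 := hτ'.1; have h4 := hτ'.2
        push_cast at h2 h4
        constructor <;> linarith
      rw [← sub_mul, norm_mul]
      exact mul_le_mul hfs (hC s hs') (norm_nonneg _) hepos.le
  calc _ ≤ ∑ i ∈ Finset.range n, e * C * (t / n) :=
        (Finset.abs_sum_le_sum_abs _ _).trans (Finset.sum_le_sum hterm)
    _ = e * (C * t) := by simp; field_simp
    _ < ε := by
      rw [he, div_mul_eq_mul_div, div_lt_iff₀ (by positivity)]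
      nlinarith

lemma sum_mul_sub_eq (a b : ℕ → ℝ) (n : ℕ) :
    ∑ i ∈ Finset.range n, a i * (b (i + 1) - b i) =
      a n * b n - a 0 * b 0 - ∑ i ∈ Finset.range n, b (i + 1) * (a (i + 1) - a i) := by
  induction n with
  | zero => simp
  | succ n ih => rw [Finset.sum_range_succ, ih, Finset.sum_range_succ]; ring

section Wiener

variable {Ω : Type*} [MeasurableSpace Ω] {P : Measure Ω} {W : ℝ≥0 → Ω → ℝ}

/-- The grid of step `t / n`. -/
noncomputable def gridPoint (t : ℝ≥0) (n i : ℕ) : ℝ≥0 := i * (t / n)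

lemma monotone_gridPoint (t : ℝ≥0) (n : ℕ) : Monotone (gridPoint t n) := by
  intro i j hij
  unfold gridPoint
  gcongr

/-- The characteristic function of a discrete stochastic integral against Brownian motion. -/
lemma charFun_map_sum_increments (hW : IsPreBrownianReal W P) (φ : ℕ → ℝ) (t : ℝ≥0) (n : ℕ) :
    charFun (P.map fun ω => ∑ i ∈ Finset.range n,
      φ i * (W (gridPoint t n (i + 1)) ω - W (gridPoint t n i) ω)) 1 =
      Complex.exp (-((∑ i ∈ Finset.range n, φ i ^ 2 * (t / n) : ℝ) : ℂ) / 2) := by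
  have hP : IsProbabilityMeasure P := (hW.hasLaw_eval 0).isProbabilityMeasure
  have hind := (hW.hasIndepIncrements.nat (monotone_gridPoint t n)).comp
    (fun i x => φ i * x) (fun i => by fun_prop)
  have hm : ∀ i, AEMeasurable ((fun x => φ i * x) ∘
      fun ω => W (gridPoint t n (i + 1)) ω - W (gridPoint t n i) ω) P := fun i =>
    (((hW.aemeasurable _).sub (hW.aemeasurable _)).const_mul _)
  have key := iIndepFun.charFun_map_fun_finsetSum_eq_prod (s := Finset.range n) (P := P)
    (X := fun i => (fun x => φ i * x) ∘
      fun ω => W (gridPoint t n (i + 1)) ω - W (gridPoint t n i) ω) (fun i _ => hm i)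
    (hind.precomp (g := fun i : Finset.range n => (i : ℕ)) Subtype.val_injective)
  simp only [Function.comp_def] at key
  rw [key, Finset.prod_apply]
  have hlaw : ∀ i, charFun (P.map fun ω =>
      φ i * (W (gridPoint t n (i + 1)) ω - W (gridPoint t n i) ω)) 1 =
      Complex.exp (-((φ i ^ 2 * (t / n) : ℝ) : ℂ) / 2) := by
    intro i
    have h1 := gaussianReal_const_mul (hW.hasLaw_sub (gridPoint t n (i + 1)) (gridPoint t n i)) (φ i)
    have h2 : P.map (fun ω => φ i * (W (gridPoint t n (i + 1)) ω - W (gridPoint t n i) ω)) = _ :=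
      h1.map_eq
    rw [h2, charFun_gaussianReal]
    have h3 : ((nndist (gridPoint t n (i + 1)).1 (gridPoint t n i).1 : ℝ≥0) : ℝ) = t / n := by
      rw [coe_nndist, Real.dist_eq, abs_of_nonneg]
      · simp [gridPoint]; ring
      · exact sub_nonneg.2 (monotone_gridPoint t n (Nat.le_succ i))
    congr 1
    simp only [NNReal.coe_mul, h3]
    simp
    ring
  simp_rw [hlaw]
  rw [← Complex.exp_sum]
  congr 1
  push_cast
  rw [← Finset.sum_div, Finset.sum_neg_distrib]

/-- The joint characteristic function of an independent initial value and the Wiener integral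
`φ t W_t - ∫₀ᵗ φ' W`. -/
lemma integral_exp_add_wiener (hW : IsBrownianReal W P) {Y : Ω → ℝ} (hY : AEMeasurable Y P)
    (hind : IndepFun Y (fun ω t => W t ω) P) {φ φ' : ℝ → ℝ} (hφ : ∀ s, HasDerivAt φ (φ' s) s)
    (hφ' : Continuous φ') (t : ℝ≥0) {N : Ω → ℝ}
    (hN : ∀ᵐ ω ∂P, N ω = Y ω + (φ t * W t ω - ∫ s in (0 : ℝ)..t, φ' s * W s.toNNReal ω)) :
    ∫ ω, Complex.exp (N ω * Complex.I) ∂P =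
      charFun (P.map Y) 1 * Complex.exp (-((∫ s in (0 : ℝ)..t, φ s ^ 2 : ℝ) : ℂ) / 2) := by
  have hP : IsProbabilityMeasure P := (hW.hasLaw_eval 0).isProbabilityMeasure
  have hφc : Continuous φ := continuous_iff_continuousAt.2 fun s => (hφ s).continuousAt
  set R : ℕ → Ω → ℝ := fun n ω => ∑ i ∈ Finset.range n, φ (i * (t / n)) *
    (W (gridPoint t n (i + 1)) ω - W (gridPoint t n i) ω) with hR
  have hRm : ∀ n, AEMeasurable (R n) P := fun n =>
    Finset.aemeasurable_fun_sum _ fun i _ =>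
      ((hW.aemeasurable _).sub (hW.aemeasurable _)).const_mul _
  have hYR : ∀ n, IndepFun Y (R n) P := fun n =>
    hind.comp measurable_id (ψ := fun w : ℝ≥0 → ℝ => ∑ i ∈ Finset.range n, φ (i * (t / n)) *
      (w (gridPoint t n (i + 1)) - w (gridPoint t n i))) (by fun_prop)
  have hlim : Tendsto (fun n => ∫ ω, Complex.exp ((Y ω + R n ω : ℝ) * Complex.I) ∂P) atTop
      (𝓝 (∫ ω, Complex.exp (N ω * Complex.I) ∂P)) := by
    refine tendsto_integral_of_dominated_convergence (fun _ => 1) (fun n => ?_)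
      (integrable_const _) (fun n => ?_) ?_
    · have := hY.add (hRm n)
      have h2 : AEMeasurable (fun ω => Complex.exp ((Y ω + R n ω : ℝ) * Complex.I)) P :=
        Measurable.comp_aemeasurable (g := fun x : ℝ => Complex.exp (x * Complex.I))
          (by fun_prop) this
      exact h2.aestronglyMeasurable
    · exact ae_of_all _ fun ω => by rw [Complex.norm_exp_ofReal_mul_I]
    · filter_upwards [hN, hW.cont, hW.eval_zero_ae_eq_zero] with ω h1 h2 h3
      have hc : Continuous fun s : ℝ => W s.toNNReal ω := h2.comp continuous_real_toNNReal
      have hL := tendsto_sum_mul_integral hc hφ' t.coe_nonneg (fun n i : ℕ => (i + 1 : ℕ) * (t / n))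
        (fun n i => ⟨by
          have : (0 : ℝ) ≤ t / n := by positivity
          push_cast
          nlinarith, le_rfl⟩)
      have hRe : ∀ᶠ n in atTop, φ t * W t ω - ∑ i ∈ Finset.range n,
          W (((i + 1 : ℕ) * (t / n : ℝ)).toNNReal) ω *
            ∫ s in (i * (t / n : ℝ))..((i + 1 : ℕ) * (t / n)), φ' s = R n ω := by
        filter_upwards [eventually_gt_atTop 0] with n hn
        have hn0 : (n : ℝ≥0) ≠ 0 := by exact_mod_cast hn.ne'
        have hn1 : (n : ℝ) ≠ 0 := by exact_mod_cast hn.ne'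
        have hg : ∀ i : ℕ, ((i : ℝ) * (t / n)).toNNReal = gridPoint t n i := by
          intro i
          rw [← Real.toNNReal_coe (r := gridPoint t n i)]
          simp [gridPoint]
        have hgn : gridPoint t n n = t := by simp only [gridPoint]; field_simp
        have hg0 : gridPoint t n 0 = 0 := by simp [gridPoint]
        have := sum_mul_sub_eq (fun i => φ (i * (t / n))) (fun i => W (gridPoint t n i) ω) n
        rw [hR]
        simp only at this ⊢
        rw [this, hgn, hg0, h3, mul_div_cancel₀ _ hn1]
        simp only [mul_zero, sub_zero]
        congr 1
        refine Finset.sum_congr rfl fun i _ => ?_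
        rw [hg, intervalIntegral.integral_eq_sub_of_hasDerivAt (fun s _ => hφ s)
          (hφ'.intervalIntegrable _ _)]
      have hlimR : Tendsto (fun n => R n ω) atTop
          (𝓝 (φ t * W t ω - ∫ s in (0 : ℝ)..t, φ' s * W s.toNNReal ω)) := by
        refine Tendsto.congr' hRe ?_
        simp_rw [mul_comm (φ' _)]
        exact tendsto_const_nhds.sub hL
      rw [h1]
      refine ((Complex.continuous_exp.comp (Complex.continuous_ofReal.mul
        continuous_const)).tendsto _).comp (hlimR.const_add (Y ω))
  refine tendsto_nhds_unique hlim ?_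
  have heq : ∀ n, ∫ ω, Complex.exp ((Y ω + R n ω : ℝ) * Complex.I) ∂P = charFun (P.map Y) 1 *
      Complex.exp (-((∑ i ∈ Finset.range n, φ (i * (t / n)) ^ 2 * (t / n) : ℝ) : ℂ) / 2) := by
    intro n
    have h1 := congrFun ((hYR n).charFun_map_fun_add_eq_mul hY (hRm n)) 1
    rw [Pi.mul_apply, charFun_map_sum_increments hW.toIsPreBrownianReal] at h1
    rw [← h1, charFun_apply_real, integral_map (φ := fun ω => Y ω + R n ω) (hY.add (hRm n))
      (by fun_prop)]
    simp
  simp_rw [heq]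
  refine Tendsto.const_mul _ ?_
  have hL := tendsto_sum_mul_integral (hφc.pow 2) (continuous_const (y := (1 : ℝ))) t.coe_nonneg
    (fun n i : ℕ => i * (t / n)) (fun n i => ⟨le_rfl, by
      have : (0 : ℝ) ≤ t / n := by positivity
      push_cast
      nlinarith⟩)
  have hL' : Tendsto (fun n : ℕ => ∑ i ∈ Finset.range n, φ (i * (t / n)) ^ 2 * (t / n)) atTop
      (𝓝 (∫ s in (0 : ℝ)..t, φ s ^ 2)) := by
    refine (hL.congr fun n => Finset.sum_congr rfl fun i _ => ?_).trans_eq ?_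
    · simp
      left; ring
    · simp
  exact ((Complex.continuous_exp.comp ((Complex.continuous_ofReal.neg).div_const 2)).tendsto
    _).comp hL'

end Wiener

section Flow

attribute [local instance] Matrix.linftyOpNormedRing Matrix.linftyOpNormedAlgebra

/-- The flow `exp (-s Aᵀ)` of the adjoint equation. -/
noncomputable def dualFlow (A : Matrix (Fin 2) (Fin 2) ℝ) (s : ℝ) : Matrix (Fin 2) (Fin 2) ℝ :=
  NormedSpace.exp (s • (-Aᵀ))

lemma dualFlow_zero (A : Matrix (Fin 2) (Fin 2) ℝ) : dualFlow A 0 = 1 := by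
  simp [dualFlow, NormedSpace.exp_zero]

lemma dualFlow_zero_mulVec (A : Matrix (Fin 2) (Fin 2) ℝ) (ξ : Fin 2 → ℝ) :
    dualFlow A 0 *ᵥ ξ = ξ := by
  rw [dualFlow_zero, Matrix.one_mulVec]

lemma hasDerivAt_dualFlow (A : Matrix (Fin 2) (Fin 2) ℝ) (ξ : Fin 2 → ℝ) (i : Fin 2) (s : ℝ) :
    HasDerivAt (fun r => (dualFlow A r *ᵥ ξ) i) (-(Aᵀ *ᵥ (dualFlow A s *ᵥ ξ)) i) s := by
  have h := hasDerivAt_exp_smul_const' (𝕂 := ℝ) (-Aᵀ) s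
  let T : Matrix (Fin 2) (Fin 2) ℝ →ₗ[ℝ] ℝ :=
    { toFun := fun M => (M *ᵥ ξ) i
      map_add' := fun M N => by simp [Matrix.add_mulVec]
      map_smul' := fun c M => by simp [Matrix.smul_mulVec] }
  have h2 := (LinearMap.toContinuousLinearMap T).hasFDerivAt.comp_hasDerivAt s h
  refine h2.congr_deriv ?_
  change ((-Aᵀ * dualFlow A s) *ᵥ ξ) i = _
  rw [← Matrix.mulVec_mulVec, Matrix.neg_mulVec]
  rfl

end Flow

lemma continuous_dualFlow (A : Matrix (Fin 2) (Fin 2) ℝ) (ξ : Fin 2 → ℝ) :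
    Continuous fun s => dualFlow A s *ᵥ ξ :=
  continuous_pi fun i => continuous_iff_continuousAt.2 fun s =>
    (hasDerivAt_dualFlow A ξ i s).continuousAt

/-- Variation of constants, tested against the adjoint flow. -/
lemma dotProduct_eq_of_linear {A : Matrix (Fin 2) (Fin 2) ℝ} {B : Fin 2 → ℝ}
    {z : ℝ≥0 → Fin 2 → ℝ} {w : ℝ≥0 → ℝ} (hz : Continuous z)
    (heq : ∀ (t : ℝ≥0) (i : Fin 2),
      z t i = z 0 i - (∫ s in (0 : ℝ)..t, (A *ᵥ z s.toNNReal) i) + B i * w t)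
    (ξ : Fin 2 → ℝ) (t : ℝ≥0) :
    ξ ⬝ᵥ z t = (dualFlow A t *ᵥ ξ) ⬝ᵥ z 0 +
      ((dualFlow A (t - t) *ᵥ ξ) ⬝ᵥ B * w t -
        ∫ s in (0 : ℝ)..t, (Aᵀ *ᵥ (dualFlow A (t - s) *ᵥ ξ)) ⬝ᵥ B * w s.toNNReal) := by
  set u : ℝ → Fin 2 → ℝ := fun s => dualFlow A (t - s) *ᵥ ξ with hu
  have hcz : Continuous fun s : ℝ => A *ᵥ z s.toNNReal :=
    (continuous_const (y := A)).matrix_mulVec (hz.comp continuous_real_toNNReal)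
  have hcu : Continuous u := (continuous_dualFlow A ξ).comp (continuous_const.sub continuous_id)
  have hcAu : Continuous fun s => Aᵀ *ᵥ u s := (continuous_const (y := Aᵀ)).matrix_mulVec hcu
  have hu' : ∀ s i, HasDerivAt (fun r => u r i) ((Aᵀ *ᵥ u s) i) s := by
    intro s i
    have := (hasDerivAt_dualFlow A ξ i (t - s)).comp s ((hasDerivAt_id s).const_sub (t : ℝ))
    refine this.congr_deriv ?_
    simp [hu]
  set V : ℝ → Fin 2 → ℝ := fun s i => z 0 i - ∫ r in (0 : ℝ)..s, (A *ᵥ z r.toNNReal) i with hV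
  have hV' : ∀ s i, HasDerivAt (fun r => V r i) (-(A *ᵥ z s.toNNReal) i) s := fun s i => by
    have hci : Continuous fun r : ℝ => (A *ᵥ z r.toNNReal) i := (continuous_apply i).comp hcz
    exact (intervalIntegral.integral_hasDerivAt_right (hci.intervalIntegrable _ _)
      (hci.stronglyMeasurableAtFilter _ _) hci.continuousAt).const_sub _
  have hVz : ∀ s : ℝ, 0 ≤ s → ∀ i, V s i = z s.toNNReal i - B i * w s.toNNReal := by
    intro s hs i
    have := heq s.toNNReal i
    rw [Real.coe_toNNReal s hs] at this
    simp only [hV]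
    linarith
  have hG : ∀ s, HasDerivAt (fun r => u r ⬝ᵥ V r)
      ((Aᵀ *ᵥ u s) ⬝ᵥ V s - u s ⬝ᵥ (A *ᵥ z s.toNNReal)) s := by
    intro s
    have := HasDerivAt.fun_sum (u := Finset.univ) (fun i _ => (hu' s i).mul (hV' s i))
    refine this.congr_deriv ?_
    simp only [dotProduct, Fin.sum_univ_two]
    ring
  have hcV : Continuous V := continuous_pi fun i => continuous_iff_continuousAt.2 fun s =>
    (hV' s i).continuousAt
  have hftc := intervalIntegral.integral_eq_sub_of_hasDerivAt (a := 0) (b := (t : ℝ))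
    (fun s _ => hG s) (((hcAu.dotProduct hcV).sub
      (hcu.dotProduct hcz)).intervalIntegrable _ _)
  have hcongr : ∫ s in (0 : ℝ)..t, ((Aᵀ *ᵥ u s) ⬝ᵥ V s - u s ⬝ᵥ (A *ᵥ z s.toNNReal)) =
      -∫ s in (0 : ℝ)..t, (Aᵀ *ᵥ u s) ⬝ᵥ B * w s.toNNReal := by
    rw [← intervalIntegral.integral_neg]
    refine intervalIntegral.integral_congr fun s hs => ?_
    rw [Set.uIcc_of_le t.coe_nonneg] at hs
    have h1 : V s = z s.toNNReal - w s.toNNReal • B := by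
      ext i; rw [hVz s hs.1]; simp [mul_comm]
    have h2 : (Aᵀ *ᵥ u s) ⬝ᵥ z s.toNNReal = u s ⬝ᵥ (A *ᵥ z s.toNNReal) := by
      rw [Matrix.mulVec_transpose, Matrix.dotProduct_mulVec]
    simp only [h1, dotProduct_sub, h2, dotProduct_smul, smul_eq_mul]
    ring
  rw [hcongr] at hftc
  have hVt : V t = z t - w t • B := by
    ext i; rw [hVz t t.coe_nonneg]; simp [mul_comm]
  have hV0 : V 0 = z 0 := by ext i; simp [hV]
  have hut : u t = ξ := by simp only [hu, sub_self, dualFlow_zero_mulVec]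
  have hu0 : u 0 = dualFlow A t *ᵥ ξ := by simp [hu]
  have hut' : dualFlow A (t - t : ℝ) *ᵥ ξ = ξ := hut
  rw [hVt, hV0, hut, hu0, dotProduct_sub, dotProduct_smul, smul_eq_mul] at hftc
  rw [hut']
  linarith

section Law

variable {Ω : Type*} [MeasurableSpace Ω] {P : Measure Ω} {W : ℝ≥0 → Ω → ℝ} {Z : ℝ≥0 → Ω → Plane}
  {A : Matrix (Fin 2) (Fin 2) ℝ} {B : Fin 2 → ℝ}

lemma SolvesLinear.charFun_map (h : SolvesLinear A B P W Z) (t : ℝ≥0) (ξ : Plane) :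
    charFun (P.map (Z t)) ξ =
      charFun (P.map (Z 0)) (WithLp.toLp 2 (dualFlow A t *ᵥ ξ.ofLp)) *
        Complex.exp (-((∫ s in (0 : ℝ)..t, ((dualFlow A s *ᵥ ξ.ofLp) ⬝ᵥ B) ^ 2 : ℝ) : ℂ) / 2) := by
  set η : Plane := WithLp.toLp 2 (dualFlow A t *ᵥ ξ.ofLp) with hη
  have hinner : ∀ x y : Plane, inner ℝ x y = y.ofLp ⬝ᵥ x.ofLp := fun x y => by
    simp [EuclideanSpace.inner_eq_star_dotProduct]
  have hYm : AEMeasurable (fun ω => inner ℝ (Z 0 ω) η) P :=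
    (h.aemeasurable 0).inner_const
  have hind : IndepFun (fun ω => inner ℝ (Z 0 ω) η) (fun ω t => W t ω) P :=
    h.indep.comp (φ := fun z : Plane => inner ℝ z η) (by fun_prop) measurable_id
  set φ : ℝ → ℝ := fun s => (dualFlow A (t - s) *ᵥ ξ.ofLp) ⬝ᵥ B
  set φ' : ℝ → ℝ := fun s => (Aᵀ *ᵥ (dualFlow A (t - s) *ᵥ ξ.ofLp)) ⬝ᵥ B
  have hcu : Continuous fun s : ℝ => dualFlow A (t - s) *ᵥ ξ.ofLp :=
    (continuous_dualFlow A ξ.ofLp).comp (continuous_const.sub continuous_id)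
  have hφ : ∀ s, HasDerivAt φ (φ' s) s := by
    intro s
    have := HasDerivAt.fun_sum (u := Finset.univ) (fun i _ =>
      ((hasDerivAt_dualFlow A ξ.ofLp i (t - s)).comp s
        ((hasDerivAt_id s).const_sub (t : ℝ))).mul_const (B i))
    refine this.congr_deriv ?_
    simp [φ', dotProduct]
  have hφ' : Continuous φ' :=
    ((continuous_const (y := Aᵀ)).matrix_mulVec hcu).dotProduct continuous_const
  have key := integral_exp_add_wiener h.brownian hYm hind hφ hφ' t
    (N := fun ω => inner ℝ (Z t ω) ξ) (by
      filter_upwards [h.continuous, h.equation] with ω h1 h3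
      have := dotProduct_eq_of_linear (z := fun t => (Z t ω).ofLp) (w := fun t => W t ω)
        ((PiLp.continuous_ofLp 2 _).comp h1) h3 ξ.ofLp t
      rw [hinner, hinner]
      exact this)
  have hmap : charFun (P.map fun ω => inner ℝ (Z 0 ω) η) 1 = charFun (P.map (Z 0)) η := by
    rw [charFun_apply_real, charFun_apply, integral_map hYm (by fun_prop),
      integral_map (h.aemeasurable 0) (by fun_prop)]
    simp
  rw [charFun_apply, integral_map (h.aemeasurable t) (by fun_prop), key, hmap]
  congr 4
  simpa [φ] using congrArg (fun x : ℝ => (x : ℂ)) (intervalIntegral.integral_comp_sub_left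
    (fun s => ((dualFlow A s *ᵥ ξ.ofLp) ⬝ᵥ B) ^ 2) (t : ℝ) (a := 0) (b := (t : ℝ)))

end Law

lemma integral_sq_dualFlow {A S : Matrix (Fin 2) (Fin 2) ℝ} {B : Fin 2 → ℝ}
    (hL : A * S + S * Aᵀ = Matrix.vecMulVec B B) (ξ : Fin 2 → ℝ) (t : ℝ) :
    ∫ s in (0 : ℝ)..t, ((dualFlow A s *ᵥ ξ) ⬝ᵥ B) ^ 2 =
      ξ ⬝ᵥ S *ᵥ ξ - (dualFlow A t *ᵥ ξ) ⬝ᵥ S *ᵥ (dualFlow A t *ᵥ ξ) := by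
  set u : ℝ → Fin 2 → ℝ := fun s => dualFlow A s *ᵥ ξ with hu
  have hd : ∀ s, HasDerivAt (fun r => -(u r ⬝ᵥ S *ᵥ u r)) ((u s ⬝ᵥ B) ^ 2) s := by
    intro s
    have hu' := fun i => hasDerivAt_dualFlow A ξ i s
    have hSu : ∀ i, HasDerivAt (fun r => (S *ᵥ u r) i) (-(S *ᵥ (Aᵀ *ᵥ u s)) i) s := by
      intro i
      refine (HasDerivAt.fun_sum (u := Finset.univ)
        (fun j _ => (hu' j).const_mul (S i j))).congr_deriv ?_
      simp [Matrix.mulVec, dotProduct, hu]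
      ring
    refine (HasDerivAt.fun_sum (u := Finset.univ)
      (fun i _ => (hu' i).mul (hSu i))).neg.congr_deriv ?_
    have h1 : (u s ⬝ᵥ B) ^ 2 = u s ⬝ᵥ (Matrix.vecMulVec B B *ᵥ u s) := by
      rw [Matrix.vecMulVec_mulVec, dotProduct_comm B]
      simp [pow_two]
      ring
    rw [h1, ← hL, Matrix.add_mulVec, dotProduct_add, ← Matrix.mulVec_mulVec,
      ← Matrix.mulVec_mulVec, Matrix.dotProduct_mulVec _ A, ← Matrix.mulVec_transpose]
    simp only [dotProduct, Fin.sum_univ_two, hu]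
    ring
  rw [intervalIntegral.integral_eq_sub_of_hasDerivAt (fun s _ => hd s)]
  · simp only [hu, dualFlow_zero_mulVec]; ring
  · exact (((continuous_dualFlow A ξ).dotProduct continuous_const).pow 2).intervalIntegrable _ _

section Drift

variable {cf cg k lam : ℝ}

lemma lyapunov_stationaryCov (hcf : 0 < cf) (hcg : 0 < cg) (hlam : 0 < lam) :
    driftMatrix cf cg k lam * stationaryCov cf cg k lam +
      stationaryCov cf cg k lam * (driftMatrix cf cg k lam)ᵀ =
        Matrix.vecMulVec diffusionVector diffusionVector := by
  have h2 : √2 * √2 = 2 := Real.mul_self_sqrt (by norm_num)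
  have hD : (cf + k ^ 2 * cg) ≠ 0 := by positivity
  have hD' : (1 + lam * cf * cg) ≠ 0 := by positivity
  ext i j
  simp only [Matrix.add_apply, Matrix.mul_apply, Fin.sum_univ_two, Matrix.transpose_apply,
    Matrix.vecMulVec_apply]
  fin_cases i <;> fin_cases j <;>
    simp [driftMatrix, stationaryCov, diffusionVector, h2] <;> field_simp <;> ring

/-- The weighted square norm `a² + lam b²` decays along the adjoint flow. -/
lemma tendsto_dualFlow (hcf : 0 < cf) (hcg : 0 < cg) (hlam : 0 < lam) (ξ : Fin 2 → ℝ) (i : Fin 2) :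
    Tendsto (fun s => (dualFlow (driftMatrix cf cg k lam) s *ᵥ ξ) i) atTop (𝓝 0) := by
  set u : ℝ → Fin 2 → ℝ := fun s => dualFlow (driftMatrix cf cg k lam) s *ᵥ ξ with hu
  set c : ℝ := min cg⁻¹ (lam * cf) with hc
  have hcpos : 0 < c := lt_min (by positivity) (by positivity)
  have h0 : ∀ s, HasDerivAt (fun r => u r 0) (-(cg⁻¹ * u s 0 + -lam * k * u s 1)) s := fun s => by
    refine (hasDerivAt_dualFlow (driftMatrix cf cg k lam) ξ 0 s).congr_deriv ?_
    simp [driftMatrix, Matrix.mulVec, dotProduct, Fin.sum_univ_two, hu]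
  have h1 : ∀ s, HasDerivAt (fun r => u r 1) (-(k * u s 0 + lam * cf * u s 1)) s := fun s => by
    refine (hasDerivAt_dualFlow (driftMatrix cf cg k lam) ξ 1 s).congr_deriv ?_
    simp [driftMatrix, Matrix.mulVec, dotProduct, Fin.sum_univ_two, hu]
  set V : ℝ → ℝ := fun s => u s 0 ^ 2 + lam * u s 1 ^ 2 with hV
  have hG : ∀ s, HasDerivAt (fun r => Real.exp (2 * c * r) * V r)
      (2 * Real.exp (2 * c * s) * (c * V s - cg⁻¹ * u s 0 ^ 2 - lam * (lam * cf) * u s 1 ^ 2)) s := by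
    intro s
    have he : HasDerivAt (fun r => Real.exp (2 * c * r)) (Real.exp (2 * c * s) * (2 * c)) s := by
      simpa using ((hasDerivAt_id s).const_mul (2 * c)).exp
    refine (he.mul (((h0 s).pow 2).add (((h1 s).pow 2).const_mul lam))).congr_deriv ?_
    simp [hV]
    ring
  have hanti : Antitone fun r => Real.exp (2 * c * r) * V r := by
    refine antitone_of_deriv_nonpos (fun s => (hG s).differentiableAt) fun s => ?_
    rw [(hG s).deriv]
    refine mul_nonpos_of_nonneg_of_nonpos (by positivity) ?_
    have hc1 : c ≤ cg⁻¹ := min_le_left _ _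
    have hc2 : c ≤ lam * cf := min_le_right _ _
    have e1 := mul_le_mul_of_nonneg_right hc1 (sq_nonneg (u s 0))
    have e2 := mul_le_mul_of_nonneg_right hc2 (mul_nonneg hlam.le (sq_nonneg (u s 1)))
    simp only [hV]
    nlinarith
  have hVle : ∀ s, 0 ≤ s → V s ≤ V 0 * Real.exp (-(2 * c * s)) := by
    intro s hs
    have := hanti hs
    simp only [mul_zero, Real.exp_zero, one_mul] at this
    rw [Real.exp_neg, ← div_eq_mul_inv, le_div_iff₀ (Real.exp_pos _)]
    linarith
  have hV0 : Tendsto V atTop (𝓝 0) := by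
    refine squeeze_zero' (Eventually.of_forall fun s => by simp only [hV]; positivity)
      ((eventually_ge_atTop 0).mono hVle) ?_
    have : Tendsto (fun s : ℝ => Real.exp (-(2 * c * s))) atTop (𝓝 0) :=
      Real.tendsto_exp_neg_atTop_nhds_zero.comp (tendsto_id.const_mul_atTop (by positivity))
    simpa using this.const_mul (V 0)
  have hsq : Tendsto (fun s => u s i ^ 2) atTop (𝓝 0) := by
    fin_cases i
    · refine squeeze_zero (fun s => sq_nonneg _) (fun s => ?_) hV0
      simp only [hV, Fin.zero_eta]
      have := mul_nonneg hlam.le (sq_nonneg (u s 1))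
      linarith
    · have h3 : Tendsto (fun s => V s / lam) atTop (𝓝 0) := by simpa using hV0.div_const lam
      refine squeeze_zero (fun s => sq_nonneg _) (fun s => ?_) h3
      rw [le_div_iff₀ hlam]
      simp only [hV, Fin.mk_one]
      nlinarith [sq_nonneg (u s 0)]
  have habs : Tendsto (fun s => |u s i|) atTop (𝓝 0) := by
    have := (Real.continuous_sqrt.tendsto 0).comp hsq
    simpa [Function.comp_def, Real.sqrt_sq_eq_abs] using this
  exact (tendsto_zero_iff_abs_tendsto_zero _).2 habs

/-- The noise enters both coordinates: the controllability Gramian is positive definite. -/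
lemma integral_sq_dualFlow_pos (hk : k ≠ 0) (hlam : 0 < lam) {ξ : Fin 2 → ℝ} (hξ : ξ ≠ 0)
    {t : ℝ} (ht : 0 < t) :
    0 < ∫ s in (0 : ℝ)..t,
      ((dualFlow (driftMatrix cf cg k lam) s *ᵥ ξ) ⬝ᵥ diffusionVector) ^ 2 := by
  set u : ℝ → Fin 2 → ℝ := fun s => dualFlow (driftMatrix cf cg k lam) s *ᵥ ξ with hu
  have hB : ∀ s, u s ⬝ᵥ diffusionVector = √2 * u s 0 := fun s => by
    simp [dotProduct, diffusionVector, Fin.sum_univ_two, mul_comm]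
  have h0 : HasDerivAt (fun r => u r 0) (-(cg⁻¹ * ξ 0 + -lam * k * ξ 1)) 0 := by
    refine (hasDerivAt_dualFlow (driftMatrix cf cg k lam) ξ 0 0).congr_deriv ?_
    simp [driftMatrix, Matrix.mulVec, dotProduct, Fin.sum_univ_two, dualFlow_zero]
  have hu0 : u 0 = ξ := dualFlow_zero_mulVec _ ξ
  refine intervalIntegral.integral_pos ht
    (((continuous_dualFlow _ ξ).dotProduct continuous_const).pow 2).continuousOn
    (fun s _ => sq_nonneg _) ?_
  by_contra! hcon
  have hz : ∀ s ∈ Set.Icc 0 t, u s 0 = 0 := by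
    intro s hs
    have h1 := hcon s hs
    change (u s ⬝ᵥ diffusionVector) ^ 2 ≤ 0 at h1
    rw [hB, mul_pow, Real.sq_sqrt (by norm_num)] at h1
    nlinarith [sq_nonneg (u s 0)]
  have hmem : (0 : ℝ) ∈ Set.Icc 0 t := ⟨le_rfl, ht.le⟩
  have hξ0 : ξ 0 = 0 := hu0 ▸ hz 0 hmem
  have hd := (uniqueDiffOn_Icc ht 0 hmem).eq_deriv _ h0.hasDerivWithinAt
    ((hasDerivWithinAt_const (0 : ℝ) (Set.Icc 0 t) (0 : ℝ)).congr hz (hz 0 hmem))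
  have hξ1 : ξ 1 = 0 := by
    rw [hξ0] at hd
    have : lam * k * ξ 1 = 0 := by linarith
    simpa [hlam.ne', hk] using this
  exact hξ (by ext i; fin_cases i <;> simp [hξ0, hξ1])

end Drift

section Gaussian

lemma inner_eq_dotProduct (x y : Plane) : inner ℝ x y = y.ofLp ⬝ᵥ x.ofLp := by
  simp [EuclideanSpace.inner_eq_star_dotProduct]

/-- The affine map `x ↦ m + G x` of the plane. -/
noncomputable def affineMap (m : Plane) (G : Matrix (Fin 2) (Fin 2) ℝ) (x : Plane) : Plane :=
  m + Matrix.toEuclideanCLM (𝕜 := ℝ) G x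

lemma continuous_affineMap (m : Plane) (G : Matrix (Fin 2) (Fin 2) ℝ) :
    Continuous (affineMap m G) :=
  continuous_const.add (Matrix.toEuclideanCLM (𝕜 := ℝ) G).continuous

lemma map_affineMap_stdGaussian (m : Plane) (G : Matrix (Fin 2) (Fin 2) ℝ) :
    (stdGaussian Plane).map (affineMap m G) = multivariateGaussian m (G * Gᵀ) := by
  have hm := (continuous_affineMap m G).measurable
  have : IsProbabilityMeasure ((stdGaussian Plane).map (affineMap m G)) :=
    Measure.isProbabilityMeasure_map hm.aemeasurable
  refine Measure.ext_of_charFun (funext fun ξ => ?_)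
  have hps : (G * Gᵀ).PosSemidef := by
    simpa using Matrix.posSemidef_self_mul_conjTranspose G
  rw [charFun_multivariateGaussian hps, charFun_apply, integral_map hm.aemeasurable (by fun_prop)]
  have hin : ∀ x, Complex.exp (inner ℝ (affineMap m G x) ξ * Complex.I) =
      Complex.exp (inner ℝ ξ m * Complex.I) *
        Complex.exp (inner ℝ x (WithLp.toLp 2 (Gᵀ *ᵥ ξ.ofLp)) * Complex.I) := by
    intro x
    rw [← Complex.exp_add, ← add_mul, ← Complex.ofReal_add]
    congr 3
    rw [affineMap, inner_add_left, real_inner_comm ξ m]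
    congr 1
    simp only [inner_eq_dotProduct, Matrix.ofLp_toEuclideanCLM]
    rw [Matrix.mulVec_transpose, Matrix.dotProduct_mulVec]
  simp_rw [hin]
  rw [integral_const_mul, ← charFun_apply, charFun_stdGaussian, ← Complex.exp_add]
  congr 1
  have hn : ‖(WithLp.toLp 2 (Gᵀ *ᵥ ξ.ofLp) : Plane)‖ ^ 2 = ξ.ofLp ⬝ᵥ (G * Gᵀ) *ᵥ ξ.ofLp := by
    rw [← real_inner_self_eq_norm_sq, inner_eq_dotProduct, ← Matrix.mulVec_mulVec,
      Matrix.dotProduct_mulVec ξ.ofLp, ← Matrix.mulVec_transpose]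
  rw [← Complex.ofReal_pow, hn]
  ring

/-- The lower triangular Cholesky factor of a `2 × 2` matrix with positive first entry. -/
noncomputable def cholesky (S : Matrix (Fin 2) (Fin 2) ℝ) : Matrix (Fin 2) (Fin 2) ℝ :=
  !![√(S 0 0), 0; S 0 1 / √(S 0 0), √(S 1 1 - S 0 1 ^ 2 / S 0 0)]

lemma cholesky_mul_transpose {S : Matrix (Fin 2) (Fin 2) ℝ} (hS : S.PosSemidef)
    (h0 : 0 < S 0 0) : cholesky S * (cholesky S)ᵀ = S := by
  have hsymm : S 1 0 = S 0 1 := by simpa using hS.1.apply 0 1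
  have hdet := hS.det_nonneg
  rw [Matrix.det_fin_two, hsymm] at hdet
  have hc : 0 ≤ S 1 1 - S 0 1 ^ 2 / S 0 0 := by
    rw [sub_nonneg, div_le_iff₀ h0]; nlinarith
  have hs : √(S 0 0) * √(S 0 0) = S 0 0 := Real.mul_self_sqrt h0.le
  have hs' := Real.mul_self_sqrt hc
  have hne : √(S 0 0) ≠ 0 := (Real.sqrt_pos.2 h0).ne'
  ext i j
  simp only [Matrix.mul_apply, Fin.sum_univ_two, Matrix.transpose_apply]
  fin_cases i <;> fin_cases j <;> simp [cholesky, hs, hsymm]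
  · field_simp
  · field_simp
  · rw [hs', div_mul_div_comm, hs]; ring

lemma continuousAt_cholesky {S : Matrix (Fin 2) (Fin 2) ℝ} (h0 : 0 < S 0 0) :
    ContinuousAt cholesky S := by
  have he : ∀ i j, ContinuousAt (fun S : Matrix (Fin 2) (Fin 2) ℝ => S i j) S := fun i j =>
    (continuous_id.matrix_elem i j).continuousAt
  have hsq : √(S 0 0) ≠ 0 := (Real.sqrt_pos.2 h0).ne'
  refine continuousAt_pi.2 fun i => continuousAt_pi.2 fun j => ?_
  fin_cases i <;> fin_cases j
  · exact (he 0 0).sqrt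
  · exact continuousAt_const
  · exact (he 0 1).div (he 0 0).sqrt hsq
  · exact ((he 1 1).sub (((he 0 1).pow 2).div (he 0 0) h0.ne')).sqrt

lemma wasserstein_map_le {E : Type*} [MeasurableSpace E] {μ : Measure E} {T T' : E → Plane}
    (hT : Measurable T) (hT' : Measurable T') :
    wasserstein (μ.map T) (μ.map T') ≤ (∫⁻ x, edist (T x) (T' x) ^ 2 ∂μ) ^ (1 / 2 : ℝ) := by
  refine ENNReal.rpow_le_rpow ?_ (by norm_num)
  have hmem : μ.map (fun x => (T x, T' x)) ∈
      {γ : Measure (Plane × Plane) | γ.fst = μ.map T ∧ γ.snd = μ.map T'} :=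
    ⟨Measure.fst_map_prodMk hT', Measure.snd_map_prodMk hT⟩
  refine (iInf₂_le _ hmem).trans_eq ?_
  rw [lintegral_map (by fun_prop) (hT.prodMk hT')]

variable {ι : Type*} {l : Filter ι} {m : ι → Plane} {m₀ : Plane}
  {G S : ι → Matrix (Fin 2) (Fin 2) ℝ} {G₀ S₀ : Matrix (Fin 2) (Fin 2) ℝ}

lemma tendsto_toEuclideanCLM (hG : Tendsto G l (𝓝 G₀)) :
    Tendsto (fun i => Matrix.toEuclideanCLM (𝕜 := ℝ) (G i)) l
      (𝓝 (Matrix.toEuclideanCLM (𝕜 := ℝ) G₀)) := by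
  let T : Matrix (Fin 2) (Fin 2) ℝ →ₗ[ℝ] (Plane →L[ℝ] Plane) :=
    { toFun := fun M => Matrix.toEuclideanCLM (𝕜 := ℝ) M
      map_add' := fun M N => map_add _ M N
      map_smul' := fun c M => map_smul _ c M }
  exact (T.continuous_of_finiteDimensional.tendsto G₀).comp hG

lemma tendstoWeakly_map_affineMap [l.IsCountablyGenerated] (hm : Tendsto m l (𝓝 m₀))
    (hG : Tendsto G l (𝓝 G₀)) :
    TendstoWeakly (fun i => (stdGaussian Plane).map (affineMap (m i) (G i))) l
      ((stdGaussian Plane).map (affineMap m₀ G₀)) := by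
  intro φ
  have h : ∀ m G, ∫ z, φ z ∂(stdGaussian Plane).map (affineMap m G) =
      ∫ x, φ (affineMap m G x) ∂stdGaussian Plane := fun m G =>
    integral_map (continuous_affineMap m G).measurable.aemeasurable
      φ.continuous.aestronglyMeasurable
  simp_rw [h]
  refine tendsto_integral_filter_of_dominated_convergence (fun _ => ‖φ‖)
    (Eventually.of_forall fun i =>
      (φ.continuous.comp (continuous_affineMap _ _)).aestronglyMeasurable)
    (Eventually.of_forall fun i => ae_of_all _ fun x => φ.norm_coe_le_norm _)
    (integrable_const _) (ae_of_all _ fun x => ?_)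
  refine (φ.continuous.tendsto _).comp (hm.add ?_)
  exact ((ContinuousLinearMap.apply ℝ Plane x).continuous.tendsto _).comp
    (tendsto_toEuclideanCLM hG)

lemma tendsto_wasserstein_map_affineMap (hm : Tendsto m l (𝓝 m₀)) (hG : Tendsto G l (𝓝 G₀)) :
    Tendsto (fun i => wasserstein ((stdGaussian Plane).map (affineMap (m i) (G i)))
      ((stdGaussian Plane).map (affineMap m₀ G₀))) l (𝓝 0) := by
  set K : ℝ := ∫ x, ‖x‖ ^ 2 ∂stdGaussian Plane with hK
  have hint : Integrable (fun x : Plane => ‖x‖ ^ 2) (stdGaussian Plane) :=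
    (IsGaussian.memLp_two_id (μ := stdGaussian Plane)).integrable_norm_pow (by norm_num)
  set a : ι → ℝ := fun i => ‖m i - m₀‖ with ha
  set b : ι → ℝ := fun i =>
    ‖Matrix.toEuclideanCLM (𝕜 := ℝ) (G i) - Matrix.toEuclideanCLM (𝕜 := ℝ) G₀‖ with hb
  have hbound : ∀ i, ∫⁻ x, edist (affineMap (m i) (G i) x) (affineMap m₀ G₀ x) ^ 2
      ∂stdGaussian Plane ≤ ENNReal.ofReal (2 * a i ^ 2 + 2 * b i ^ 2 * K) := by
    intro i
    have hi : Integrable (fun x : Plane => 2 * a i ^ 2 + 2 * b i ^ 2 * ‖x‖ ^ 2)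
        (stdGaussian Plane) := (integrable_const _).add (hint.const_mul _)
    have hval : 2 * a i ^ 2 + 2 * b i ^ 2 * K =
        ∫ x, (2 * a i ^ 2 + 2 * b i ^ 2 * ‖x‖ ^ 2) ∂stdGaussian Plane := by
      rw [integral_add (integrable_const _) (hint.const_mul _)]
      simp [hK, integral_const_mul]
    rw [hval, ofReal_integral_eq_lintegral_ofReal hi (ae_of_all _ fun x => by positivity)]
    refine lintegral_mono fun x => ?_
    rw [edist_dist, ← ENNReal.ofReal_pow dist_nonneg]
    refine ENNReal.ofReal_le_ofReal ?_
    have hd : dist (affineMap (m i) (G i) x) (affineMap m₀ G₀ x) ≤ a i + b i * ‖x‖ := by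
      rw [dist_eq_norm, affineMap, affineMap, add_sub_add_comm, ← sub_apply]
      exact (norm_add_le _ _).trans (by gcongr; exact ContinuousLinearMap.le_opNorm _ _)
    have h2 := pow_le_pow_left₀ dist_nonneg hd 2
    nlinarith [sq_nonneg (a i - b i * ‖x‖)]
  have ha0 : Tendsto a l (𝓝 0) := by
    simpa [ha] using (hm.sub_const m₀).norm
  have hb0 : Tendsto b l (𝓝 0) := by
    simpa [hb] using ((tendsto_toEuclideanCLM hG).sub_const
      (Matrix.toEuclideanCLM (𝕜 := ℝ) G₀)).norm
  have hlim : Tendsto (fun i => (ENNReal.ofReal (2 * a i ^ 2 + 2 * b i ^ 2 * K)) ^ (1 / 2 : ℝ)) l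
      (𝓝 0) := by
    have h1 : Tendsto (fun i => 2 * a i ^ 2 + 2 * b i ^ 2 * K) l (𝓝 0) := by
      simpa using ((ha0.pow 2).const_mul 2).add (((hb0.pow 2).const_mul 2).mul_const K)
    have h2 := ((ENNReal.continuous_rpow_const (y := (1 / 2 : ℝ))).tendsto _).comp
      (ENNReal.tendsto_ofReal h1)
    simpa [Function.comp_def] using h2
  refine tendsto_of_tendsto_of_tendsto_of_le_of_le tendsto_const_nhds hlim (fun _ => zero_le) ?_
  intro i
  exact (wasserstein_map_le (continuous_affineMap _ _).measurable
    (continuous_affineMap _ _).measurable).trans (ENNReal.rpow_le_rpow (hbound i) (by norm_num))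

/-- Gaussian laws with convergent parameters converge, provided that the first variance of the
limit is positive. -/
lemma tendsto_multivariateGaussian [l.IsCountablyGenerated] {μ : ι → Measure Plane}
    (hμ : ∀ᶠ i in l, (S i).PosSemidef ∧ μ i = multivariateGaussian (m i) (S i))
    (hS₀ : S₀.PosSemidef) (h0 : 0 < S₀ 0 0) (hm : Tendsto m l (𝓝 m₀)) (hS : Tendsto S l (𝓝 S₀)) :
    TendstoWeakly μ l (multivariateGaussian m₀ S₀) ∧
      Tendsto (fun i => wasserstein (μ i) (multivariateGaussian m₀ S₀)) l (𝓝 0) := by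
  have hC : Tendsto (fun i => cholesky (S i)) l (𝓝 (cholesky S₀)) :=
    (continuousAt_cholesky h0).tendsto.comp hS
  have hS00 : Tendsto (fun i => S i 0 0) l (𝓝 (S₀ 0 0)) :=
    ((continuous_id.matrix_elem 0 0).tendsto S₀).comp hS
  have hev : ∀ᶠ i in l,
      (stdGaussian Plane).map (affineMap (m i) (cholesky (S i))) = μ i := by
    filter_upwards [hμ, hS00.eventually_const_lt h0] with i hi hpos
    rw [map_affineMap_stdGaussian, cholesky_mul_transpose hi.1 hpos, hi.2]
  have h₀ : (stdGaussian Plane).map (affineMap m₀ (cholesky S₀)) = multivariateGaussian m₀ S₀ := by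
    rw [map_affineMap_stdGaussian, cholesky_mul_transpose hS₀ h0]
  refine ⟨fun φ => ?_, ?_⟩
  · refine ((h₀ ▸ tendstoWeakly_map_affineMap hm hC) φ).congr' ?_
    filter_upwards [hev] with i hi
    simp only [hi]
  · refine (h₀ ▸ tendsto_wasserstein_map_affineMap hm hC).congr' ?_
    filter_upwards [hev] with i hi
    rw [hi]

/-- A Gaussian law on the plane is determined by its mean and covariance matrix. -/
lemma exists_eq_multivariateGaussian (μ : Measure Plane) [IsGaussian μ] :
    ∃ (m : Plane) (C : Matrix (Fin 2) (Fin 2) ℝ), C.PosSemidef ∧ μ = multivariateGaussian m C := by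
  set e : Fin 2 → Plane := fun i => EuclideanSpace.single i 1
  set C : Matrix (Fin 2) (Fin 2) ℝ := Matrix.of fun i j => covarianceBilin μ (e i) (e j) with hC
  have hquad : ∀ x : Plane, covarianceBilin μ x x = x.ofLp ⬝ᵥ C *ᵥ x.ofLp := by
    intro x
    have hx : x = x 0 • e 0 + x 1 • e 1 := by
      ext i; fin_cases i <;> simp [e]
    have hexp : covarianceBilin μ x x =
        covarianceBilin μ (x 0 • e 0 + x 1 • e 1) (x 0 • e 0 + x 1 • e 1) := by rw [← hx]
    rw [hexp]
    simp only [map_add, map_smul, add_apply, smul_apply, smul_eq_mul, dotProduct, Matrix.mulVec,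
      Fin.sum_univ_two, hC, Matrix.of_apply]
    ring
  have hps : C.PosSemidef := by
    refine .of_dotProduct_mulVec_nonneg ?_ fun x => ?_
    · ext i j
      simp [hC, covarianceBilin_comm (e j) (e i)]
    · exact (covarianceBilin_self_nonneg (μ := μ) (WithLp.toLp 2 x)).trans_eq
        (hquad (WithLp.toLp 2 x))
  refine ⟨μ[id], C, hps, Measure.ext_of_charFun (funext fun ξ => ?_)⟩
  rw [charFun_multivariateGaussian hps, IsGaussian.charFun_eq', hquad]

end Gaussian

section Smoothing

open Complex

/-- The density of the isotropic centred Gaussian of variance `ε`. -/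
noncomputable def gaussianKernel (ε : ℝ) (z : Plane) : ℝ :=
  (2 * Real.pi * ε)⁻¹ * Real.exp (-(2 * ε)⁻¹ * ‖z‖ ^ 2)

lemma gaussianKernel_nonneg {ε : ℝ} (hε : 0 < ε) (z : Plane) : 0 ≤ gaussianKernel ε z := by
  have := Real.pi_pos
  unfold gaussianKernel
  positivity

lemma continuous_gaussianKernel (ε : ℝ) : Continuous (gaussianKernel ε) := by
  unfold gaussianKernel
  fun_prop

lemma integral_cexp_plane {b : ℝ} (hb : 0 < b) (c : ℂ) (w : Plane) :
    ∫ v : Plane, cexp (-b * ‖v‖ ^ 2 + c * inner ℝ w v) =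
      (Real.pi / b : ℝ) * cexp (c ^ 2 * ‖w‖ ^ 2 / (4 * b)) := by
  rw [GaussianFourier.integral_cexp_neg_mul_sq_norm_add (b := (b : ℂ)) (by simpa using hb)]
  simp

/-- The isotropic Gaussian, as a measure. -/
noncomputable def gaussianKernelMeasure (ε : ℝ) : Measure Plane :=
  volume.withDensity fun z => ENNReal.ofReal (gaussianKernel ε z)

lemma integrable_exp_neg_mul_sq_norm {b : ℝ} (hb : 0 < b) :
    Integrable fun v : Plane => Real.exp (-b * ‖v‖ ^ 2) := by
  have h := (GaussianFourier.integrable_cexp_neg_mul_sq_norm_add (V := Plane) (b := (b : ℂ))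
    (by simpa using hb) 0 0).norm
  refine h.congr (ae_of_all _ fun v => ?_)
  simp only [Complex.norm_exp]
  congr 1
  simp [← ofReal_pow]

lemma integrable_gaussianKernel {ε : ℝ} (hε : 0 < ε) : Integrable (gaussianKernel ε) :=
  (integrable_exp_neg_mul_sq_norm (by positivity)).const_mul _

lemma isFiniteMeasure_gaussianKernelMeasure {ε : ℝ} (hε : 0 < ε) :
    IsFiniteMeasure (gaussianKernelMeasure ε) :=
  isFiniteMeasure_withDensity_ofReal (integrable_gaussianKernel hε).2

lemma charFun_gaussianKernelMeasure {ε : ℝ} (hε : 0 < ε) (ξ : Plane) :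
    charFun (gaussianKernelMeasure ε) ξ = cexp (-(ε * ‖ξ‖ ^ 2 : ℝ) / 2) := by
  have hpi := Real.pi_pos
  rw [charFun_apply, gaussianKernelMeasure, integral_withDensity_eq_integral_toReal_smul
    (continuous_gaussianKernel ε).measurable.ennreal_ofReal (by simp)]
  have h : ∀ x : Plane, (ENNReal.ofReal (gaussianKernel ε x)).toReal •
      cexp (inner ℝ x ξ * I) = ((2 * Real.pi * ε)⁻¹ : ℝ) *
        cexp (-((2 * ε)⁻¹ : ℝ) * ‖x‖ ^ 2 + I * inner ℝ ξ x) := by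
    intro x
    rw [ENNReal.toReal_ofReal (gaussianKernel_nonneg hε x), gaussianKernel, Complex.exp_add,
      real_smul, real_inner_comm ξ x]
    push_cast
    ring_nf
  simp_rw [h]
  rw [integral_const_mul, integral_cexp_plane (by positivity), ← mul_assoc, ← ofReal_mul]
  have h1 : (2 * Real.pi * ε)⁻¹ * (Real.pi / (2 * ε)⁻¹) = 1 := by field_simp
  rw [h1, ofReal_one, one_mul, I_sq]
  congr 1
  have : (ε : ℂ) ≠ 0 := by exact_mod_cast hε.ne'
  push_cast
  field_simp
  norm_num

/-- Convolution with the isotropic Gaussian kernel. -/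
noncomputable def smoothedDensity (ε : ℝ) (ν : Measure Plane) (z : Plane) : ℝ :=
  ∫ w, gaussianKernel ε (z - w) ∂ν

lemma smoothedDensity_nonneg {ε : ℝ} (hε : 0 < ε) (ν : Measure Plane) (z : Plane) :
    0 ≤ smoothedDensity ε ν z :=
  integral_nonneg fun _ => gaussianKernel_nonneg hε _

lemma integrable_gaussianKernel_sub {ε : ℝ} (hε : 0 < ε) (ν : Measure Plane)
    [IsProbabilityMeasure ν] (z : Plane) : Integrable (fun w => gaussianKernel ε (z - w)) ν := by
  have hpi := Real.pi_pos
  refine Integrable.mono' (integrable_const ((2 * Real.pi * ε)⁻¹))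
    ((continuous_gaussianKernel ε).comp (by fun_prop)).aestronglyMeasurable (ae_of_all _ fun w => ?_)
  rw [Real.norm_eq_abs, abs_of_nonneg (gaussianKernel_nonneg hε _), gaussianKernel]
  refine mul_le_of_le_one_right (by positivity) (Real.exp_le_one_iff.2 ?_)
  have : 0 ≤ (2 * ε)⁻¹ * ‖z - w‖ ^ 2 := by positivity
  linarith

lemma conv_gaussianKernelMeasure {ε : ℝ} (hε : 0 < ε) (ν : Measure Plane)
    [IsProbabilityMeasure ν] :
    ν ∗ gaussianKernelMeasure ε =
      volume.withDensity fun z => ENNReal.ofReal (smoothedDensity ε ν z) := by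
  have := isFiniteMeasure_gaussianKernelMeasure hε
  have hd : ∀ z, ENNReal.ofReal (smoothedDensity ε ν z) =
      ∫⁻ w, ENNReal.ofReal (gaussianKernel ε (z - w)) ∂ν := fun z =>
    ofReal_integral_eq_lintegral_ofReal (integrable_gaussianKernel_sub hε ν z)
      (ae_of_all _ fun w => gaussianKernel_nonneg hε _)
  have hkm : Measurable fun z => ENNReal.ofReal (gaussianKernel ε z) :=
    (continuous_gaussianKernel ε).measurable.ennreal_ofReal
  refine Measure.ext_of_lintegral _ fun f hf => ?_
  have hdm : Measurable fun z => ∫⁻ w, ENNReal.ofReal (gaussianKernel ε (z - w)) ∂ν :=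
    Measurable.lintegral_prod_right' (f := fun p : Plane × Plane =>
      ENNReal.ofReal (gaussianKernel ε (p.1 - p.2))) (hkm.comp (by fun_prop))
  simp_rw [hd]
  rw [Measure.lintegral_conv hf, lintegral_withDensity_eq_lintegral_mul _ hdm hf]
  have h1 : ∀ x, ∫⁻ y, f (x + y) ∂gaussianKernelMeasure ε =
      ∫⁻ z, ENNReal.ofReal (gaussianKernel ε (z - x)) * f z := by
    intro x
    have hfx : Measurable fun y => f (x + y) := hf.comp (measurable_const_add x)
    rw [gaussianKernelMeasure, lintegral_withDensity_eq_lintegral_mul _ hkm hfx,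
      ← lintegral_sub_right_eq_self (μ := volume) _ x]
    simp
  simp_rw [h1]
  rw [lintegral_lintegral_swap]
  · refine lintegral_congr fun z => ?_
    have hkz : Measurable fun x => ENNReal.ofReal (gaussianKernel ε (z - x)) :=
      hkm.comp (measurable_const_sub z)
    rw [lintegral_mul_const _ hkz]
    rfl
  · exact ((hkm.comp (by fun_prop)).mul (hf.comp measurable_snd)).aemeasurable

lemma integrable_pow_mul_exp_neg {b : ℝ} (hb : 0 < b) (n : ℕ) :
    Integrable fun v : Plane => ‖v‖ ^ n * Real.exp (-b * ‖v‖ ^ 2) := by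
  set c : ℝ := (b / 2)
  have hc : 0 < c := by positivity
  refine Integrable.mono' (g := fun v : Plane =>
    (1 + n.factorial * (c ^ n)⁻¹) * Real.exp (-c * ‖v‖ ^ 2))
    ((integrable_exp_neg_mul_sq_norm hc).const_mul _)
    (by fun_prop) (ae_of_all _ fun v => ?_)
  have hsplit : Real.exp (-b * ‖v‖ ^ 2) =
      Real.exp (-c * ‖v‖ ^ 2) * Real.exp (-c * ‖v‖ ^ 2) := by
    rw [← Real.exp_add]; congr 1; simp only [c]; ring
  have h1 : ‖v‖ ^ n ≤ 1 + (‖v‖ ^ 2) ^ n := by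
    rcases le_total ‖v‖ 1 with h | h
    · have := pow_le_one₀ (n := n) (norm_nonneg v) h
      have : 0 ≤ (‖v‖ ^ 2) ^ n := by positivity
      linarith
    · have : ‖v‖ ^ n ≤ ‖v‖ ^ (2 * n) := pow_le_pow_right₀ h (by omega)
      rw [pow_mul] at this
      linarith
  have h2 : (‖v‖ ^ 2) ^ n * Real.exp (-c * ‖v‖ ^ 2) ≤ n.factorial * (c ^ n)⁻¹ := by
    have := Real.pow_div_factorial_le_exp (c * ‖v‖ ^ 2) (by positivity) n
    rw [div_le_iff₀ (by positivity), mul_pow] at this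
    rw [neg_mul, Real.exp_neg, ← div_eq_mul_inv, ← div_eq_mul_inv,
      div_le_div_iff₀ (Real.exp_pos _) (by positivity)]
    linarith
  have h3 : Real.exp (-c * ‖v‖ ^ 2) ≤ 1 := Real.exp_le_one_iff.2 (by
    have : 0 ≤ c * ‖v‖ ^ 2 := by positivity
    linarith)
  rw [Real.norm_of_nonneg (by positivity), hsplit, ← mul_assoc]
  refine mul_le_mul_of_nonneg_right ?_ (Real.exp_pos _).le
  nlinarith [Real.exp_pos (-c * ‖v‖ ^ 2)]

/-- The smoothed density is a Fourier transform. -/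
lemma smoothedDensity_eq_fourier {ε : ℝ} (hε : 0 < ε) (ν : Measure Plane)
    [IsProbabilityMeasure ν] (z : Plane) :
    (smoothedDensity ε ν z : ℂ) = FourierTransform.fourier (fun v : Plane =>
      (Real.exp (-(2 * Real.pi ^ 2 * ε) * ‖v‖ ^ 2) : ℂ) *
        charFun ν ((2 * Real.pi) • v)) z := by
  have hpi := Real.pi_pos
  have hb : 0 < 2 * Real.pi ^ 2 * ε := by positivity
  rw [Real.fourier_eq']
  have hk : ∀ w, (gaussianKernel ε (z - w) : ℂ) = ∫ v : Plane,
      cexp ((-2 * Real.pi * inner ℝ v z : ℝ) * I) *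
        ((Real.exp (-(2 * Real.pi ^ 2 * ε) * ‖v‖ ^ 2) : ℂ) *
          cexp (inner ℝ w ((2 * Real.pi) • v) * I)) := by
    intro w
    have h := integral_cexp_plane hb (-2 * Real.pi * I) (z - w)
    rw [mul_pow, I_sq] at h
    have he : ∀ v : Plane, cexp ((-2 * Real.pi * inner ℝ v z : ℝ) * I) *
        ((Real.exp (-(2 * Real.pi ^ 2 * ε) * ‖v‖ ^ 2) : ℂ) *
          cexp (inner ℝ w ((2 * Real.pi) • v) * I)) =
        cexp (-(2 * Real.pi ^ 2 * ε : ℝ) * ‖v‖ ^ 2 + -2 * Real.pi * I * inner ℝ (z - w) v) := by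
      intro v
      rw [ofReal_exp, ← Complex.exp_add, ← Complex.exp_add, inner_sub_left, inner_smul_right,
        real_inner_comm v z]
      congr 1
      push_cast
      ring
    simp_rw [he]
    rw [h, gaussianKernel]
    push_cast
    have hε' : (ε : ℂ) ≠ 0 := by exact_mod_cast hε.ne'
    have hpi' : (Real.pi : ℂ) ≠ 0 := by exact_mod_cast hpi.ne'
    congr 1
    · field_simp
    · congr 1
      field_simp
      ring
  rw [smoothedDensity, ← integral_complex_ofReal]
  simp_rw [hk]
  rw [integral_integral_swap]
  · refine integral_congr_ae (ae_of_all _ fun v => ?_)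
    simp only [integral_const_mul, charFun_apply, smul_eq_mul]
  · have hdom : Integrable (fun p : Plane × Plane =>
        Real.exp (-(2 * Real.pi ^ 2 * ε) * ‖p.2‖ ^ 2)) (ν.prod volume) :=
      (integrable_exp_neg_mul_sq_norm hb).comp_snd ν
    refine hdom.mono' (by unfold Function.uncurry; fun_prop) (ae_of_all _ fun p => ?_)
    simp only [Function.uncurry, norm_mul, Complex.norm_exp_ofReal_mul_I, one_mul, mul_one,
      Complex.norm_real, Real.norm_eq_abs, Real.abs_exp, le_refl]

lemma contDiff_smoothedDensity {ε : ℝ} (hε : 0 < ε) (ν : Measure Plane)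
    [IsProbabilityMeasure ν] :
    ContDiff ℝ ((⊤ : ℕ∞) : WithTop ℕ∞) (smoothedDensity ε ν) := by
  have hpi := Real.pi_pos
  have hb : 0 < 2 * Real.pi ^ 2 * ε := by positivity
  set f : Plane → ℂ := fun v => (Real.exp (-(2 * Real.pi ^ 2 * ε) * ‖v‖ ^ 2) : ℂ) *
    charFun ν ((2 * Real.pi) • v) with hf
  have hfm : Measurable f := by
    have := (measurable_charFun (μ := ν)).comp (measurable_const_smul (α := Plane) (2 * Real.pi))
    refine Measurable.mul (by fun_prop) this
  have hc : ContDiff ℝ ((⊤ : ℕ∞) : WithTop ℕ∞) (FourierTransform.fourier f) := by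
    refine Real.contDiff_fourier fun n _ => ?_
    refine (integrable_pow_mul_exp_neg hb n).mono' (by fun_prop) (ae_of_all _ fun v => ?_)
    rw [Real.norm_of_nonneg (by positivity)]
    refine mul_le_mul_of_nonneg_left ?_ (by positivity)
    rw [hf]
    simp only [norm_mul, Complex.norm_real, Real.norm_eq_abs, Real.abs_exp]
    exact mul_le_of_le_one_right (Real.exp_pos _).le (norm_charFun_le_one _)
  have he : smoothedDensity ε ν = fun z => reCLM (FourierTransform.fourier f z) := by
    funext z
    rw [← smoothedDensity_eq_fourier hε ν z]
    simp
  rw [he]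
  exact reCLM.contDiff.comp hc

/-- A law whose characteristic function has a Gaussian factor has a smooth density. -/
lemma exists_smooth_density {μ ν : Measure Plane} [IsProbabilityMeasure μ]
    [IsProbabilityMeasure ν] {ε : ℝ} (hε : 0 < ε)
    (h : ∀ ξ, charFun μ ξ = charFun ν ξ * cexp (-(ε * ‖ξ‖ ^ 2 : ℝ) / 2)) :
    ∃ ρ : Plane → ℝ, ContDiff ℝ ((⊤ : ℕ∞) : WithTop ℕ∞) ρ ∧ (∀ z, 0 ≤ ρ z) ∧
      μ = volume.withDensity fun z => ENNReal.ofReal (ρ z) := by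
  have := isFiniteMeasure_gaussianKernelMeasure hε
  refine ⟨smoothedDensity ε ν, contDiff_smoothedDensity hε ν, smoothedDensity_nonneg hε ν, ?_⟩
  rw [← conv_gaussianKernelMeasure hε ν]
  refine Measure.ext_of_charFun (funext fun ξ => ?_)
  rw [h, charFun_conv, charFun_gaussianKernelMeasure hε]

end Smoothing

section Potentials

lemma fullPotential_quadPotential {cf cg : ℝ} (hcf : 0 < cf) (hcg : 0 < cg) (k x : ℝ) :
    fullPotential (quadPotential cf) (quadPotential cg) k x =
      (k ^ 2 * cg + cf) / (2 * cf * cg) * x ^ 2 := by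
  simp only [fullPotential, quadPotential]
  field_simp

lemma convexConjugate_quadPotential {c : ℝ} (hc : 0 < c) (y : ℝ) :
    convexConjugate (fun x => (quadPotential c x : EReal)) y = ((c / 2 * y ^ 2 : ℝ) : EReal) := by
  refine le_antisymm (iSup_le fun x => ?_) ?_
  · rw [← EReal.coe_sub, EReal.coe_le_coe_iff, quadPotential]
    have h : c / 2 * y ^ 2 - (x * y - 1 / (2 * c) * x ^ 2) = (x - c * y) ^ 2 / (2 * c) := by
      field_simp
      ring
    have : 0 ≤ (x - c * y) ^ 2 / (2 * c) := by positivity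
    linarith
  · refine le_trans (le_of_eq ?_) (le_iSup _ (c * y))
    rw [← EReal.coe_sub, EReal.coe_eq_coe_iff, quadPotential]
    field_simp
    ring

lemma mem_subdifferential_quadPotential {c : ℝ} (hc : 0 < c) (x p : ℝ) :
    p ∈ subdifferential (fun x => (quadPotential c x : EReal)) x ↔ p = c⁻¹ * x := by
  have h : p ∈ subdifferential (fun x => (quadPotential c x : EReal)) x ↔
      ∀ z, quadPotential c x + p * (z - x) ≤ quadPotential c z := by
    simp only [subdifferential, Set.mem_ofPred_eq, ← EReal.coe_add, EReal.coe_le_coe_iff]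
  have hid : ∀ z, quadPotential c z - (quadPotential c x + p * (z - x)) =
      ((z - c * p) ^ 2 - (x - c * p) ^ 2) / (2 * c) := fun z => by
    simp only [quadPotential]
    field_simp
    ring
  rw [h]
  constructor
  · intro H
    have h1 := hid (c * p)
    have h2 := H (c * p)
    have h3 : 0 ≤ ((c * p - c * p) ^ 2 - (x - c * p) ^ 2) / (2 * c) := by linarith
    rw [le_div_iff₀ (by positivity), sub_self] at h3
    have h5 : x - c * p = 0 := by
      have : (x - c * p) ^ 2 ≤ 0 := by linarith
      exact pow_eq_zero_iff two_ne_zero |>.1 (le_antisymm this (sq_nonneg _))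
    field_simp
    linarith
  · rintro rfl z
    have h1 := hid z
    rw [mul_inv_cancel_left₀ hc.ne', sub_self, zero_pow two_ne_zero, sub_zero] at h1
    have : 0 ≤ (z - x) ^ 2 / (2 * c) := by positivity
    linarith

lemma mem_subdifferential_convexConjugate {c : ℝ} (hc : 0 < c) (y q : ℝ) :
    q ∈ subdifferential (convexConjugate fun x => (quadPotential c x : EReal)) y ↔ q = c * y := by
  have h : convexConjugate (fun x => (quadPotential c x : EReal)) =
      fun y => (quadPotential c⁻¹ y : EReal) := by
    funext y
    rw [convexConjugate_quadPotential hc, quadPotential]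
    congr 2
    field_simp
  rw [h, mem_subdifferential_quadPotential (inv_pos.2 hc), inv_inv]

lemma deriv_quadPotential (c x : ℝ) : deriv (quadPotential c) x = c⁻¹ * x := by
  have h : HasDerivAt (quadPotential c) (1 / (2 * c) * (2 * x)) x := by
    exact ((hasDerivAt_pow 2 x).const_mul (1 / (2 * c))).congr_deriv (by simp)
  rw [h.deriv]
  rcases eq_or_ne c 0 with rfl | hc
  · simp
  · field_simp

end Potentials

section Equivalence

variable {cf cg k lam : ℝ} {Ω : Type*} [MeasurableSpace Ω] {P : Measure Ω} {W : ℝ≥0 → Ω → ℝ}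
  {Z : ℝ≥0 → Ω → Plane}

lemma driftMatrix_mulVec_zero (z : Fin 2 → ℝ) :
    (driftMatrix cf cg k lam *ᵥ z) 0 = cg⁻¹ * z 0 + k * z 1 := by
  simp [driftMatrix, Matrix.mulVec, dotProduct, Fin.sum_univ_two]

lemma driftMatrix_mulVec_one (z : Fin 2 → ℝ) :
    (driftMatrix cf cg k lam *ᵥ z) 1 = lam * (cf * z 1 - k * z 0) := by
  simp [driftMatrix, Matrix.mulVec, dotProduct, Fin.sum_univ_two]
  ring

lemma solvesPrimalDual_iff_solvesLinear (hcf : 0 < cf) (hcg : 0 < cg) :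
    SolvesPrimalDual (fun x => (quadPotential cf x : EReal))
        (fun x => (quadPotential cg x : EReal)) k lam P W Z ↔
      SolvesLinear (driftMatrix cf cg k lam) diffusionVector P W Z := by
  constructor
  · rintro ⟨hn, he⟩
    refine ⟨hn, ?_⟩
    filter_upwards [he] with ω hω
    obtain ⟨p, q, -, hpq, heq⟩ := hω
    intro t
    have hae : ∀ᵐ s : ℝ, s ∈ Set.uIoc (0 : ℝ) t →
        p s = cg⁻¹ * Z s.toNNReal ω 0 ∧ q s = cf * Z s.toNNReal ω 1 := by
      have := (ae_restrict_iff' measurableSet_Ici).1 hpq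
      filter_upwards [this] with s hs hst
      rw [Set.uIoc_of_le t.coe_nonneg] at hst
      have := hs hst.1.le
      rwa [mem_subdifferential_quadPotential hcg, mem_subdifferential_convexConjugate hcf] at this
    have h0 := (heq t).1
    have h1 := (heq t).2
    rw [intervalIntegral.integral_congr_ae
      (g := fun s => (driftMatrix cf cg k lam *ᵥ (Z s.toNNReal ω).ofLp) 0) (by
        filter_upwards [hae] with s hs hst
        rw [driftMatrix_mulVec_zero, (hs hst).1])] at h0
    rw [intervalIntegral.integral_congr_ae
      (g := fun s => (driftMatrix cf cg k lam *ᵥ (Z s.toNNReal ω).ofLp) 1) (by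
        filter_upwards [hae] with s hs hst
        rw [driftMatrix_mulVec_one, (hs hst).2])] at h1
    intro i
    fin_cases i
    · exact h0
    · simpa [diffusionVector] using h1
  · rintro ⟨hn, he⟩
    refine ⟨hn, ?_⟩
    filter_upwards [he, hn.continuous] with ω hω hc
    have hci : ∀ i : Fin 2, Continuous fun s : ℝ => Z s.toNNReal ω i := fun i =>
      (PiLp.continuous_apply 2 _ i).comp (hc.comp continuous_real_toNNReal)
    refine ⟨fun s => cg⁻¹ * Z s.toNNReal ω 0, fun s => cf * Z s.toNNReal ω 1, fun t =>
      ⟨((hci 0).const_mul _).intervalIntegrable _ _, ((hci 1).const_mul _).intervalIntegrable _ _⟩,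
      ae_of_all _ fun s => ⟨(mem_subdifferential_quadPotential hcg _ _).2 rfl,
        (mem_subdifferential_convexConjugate hcf _ _).2 rfl⟩, fun t => ⟨?_, ?_⟩⟩
    · have := hω t 0
      simp only [driftMatrix_mulVec_zero] at this
      exact this
    · have := hω t 1
      simp only [driftMatrix_mulVec_one] at this
      simpa [diffusionVector] using this

end Equivalence

section Stationary

variable {cf cg k lam : ℝ}

lemma posDef_fin_two {S : Matrix (Fin 2) (Fin 2) ℝ} (hsymm : S 1 0 = S 0 1) (h0 : 0 < S 0 0)
    (hdet : 0 < S.det) : S.PosDef := by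
  refine .of_dotProduct_mulVec_pos ?_ fun x hx => ?_
  · ext i j; fin_cases i <;> fin_cases j <;> simp [hsymm]
  · rw [Matrix.det_fin_two, hsymm] at hdet
    have hq : S 0 0 * (star x ⬝ᵥ S *ᵥ x) =
        (S 0 0 * x 0 + S 0 1 * x 1) ^ 2 + (S 0 0 * S 1 1 - S 0 1 * S 0 1) * x 1 ^ 2 := by
      simp [dotProduct, Matrix.mulVec, Fin.sum_univ_two, hsymm]
      ring
    refine pos_of_mul_pos_right ?_ h0.le
    rw [hq]
    by_cases hx1 : x 1 = 0
    · have hx0 : x 0 ≠ 0 := fun h => hx (by ext i; fin_cases i <;> simp [h, hx1])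
      rw [hx1]
      have : S 0 0 * x 0 ≠ 0 := mul_ne_zero h0.ne' hx0
      simp only [mul_zero, add_zero, ne_eq, OfNat.ofNat_ne_zero, not_false_eq_true, zero_pow]
      positivity
    · positivity

/-- A positive definite `2 × 2` matrix dominates a positive multiple of the identity. -/
lemma exists_posSemidef_sub_smul_one {S : Matrix (Fin 2) (Fin 2) ℝ} (hS : S.PosDef) :
    ∃ ε : ℝ, 0 < ε ∧ (S - ε • (1 : Matrix (Fin 2) (Fin 2) ℝ)).PosSemidef := by
  have hsymm : S 1 0 = S 0 1 := by simpa using hS.1.apply 0 1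
  have h0 : 0 < S 0 0 := hS.diag_pos
  have hdet := hS.det_pos
  have hl : Tendsto (fun ε : ℝ => S - ε • (1 : Matrix (Fin 2) (Fin 2) ℝ)) (𝓝[>] 0) (𝓝 S) := by
    have hc : Continuous fun ε : ℝ => S - ε • (1 : Matrix (Fin 2) (Fin 2) ℝ) := by fun_prop
    simpa using (hc.tendsto 0).mono_left nhdsWithin_le_nhds
  have h1 := (((continuous_id.matrix_elem 0 0).tendsto S).comp hl).eventually_const_lt h0
  have h2 := (((continuous_id.matrix_det).tendsto S).comp hl).eventually_const_lt hdet
  obtain ⟨ε, ⟨h1, h2⟩, hε⟩ := ((h1.and h2).and self_mem_nhdsWithin).exists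
  exact ⟨ε, hε, (posDef_fin_two (by simp [hsymm]) h1 h2).posSemidef⟩

lemma posDef_stationaryCov (hcf : 0 < cf) (hcg : 0 < cg) (hk : k ≠ 0) (hlam : 0 < lam) :
    (stationaryCov cf cg k lam).PosDef := by
  refine posDef_fin_two (by simp [stationaryCov]) ?_ ?_
  · simp [stationaryCov]
    positivity
  · rw [stationaryCov, Matrix.det_smul, Matrix.det_fin_two_of]
    refine mul_pos (by positivity) ?_
    have : (cg * (cf + k ^ 2 * cg) + lam * cf ^ 2 * cg ^ 2) * (k ^ 2 * lam * cg ^ 2) -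
        k * lam * cf * cg ^ 2 * (k * lam * cf * cg ^ 2) =
        cg * (cf + k ^ 2 * cg) * (k ^ 2 * lam * cg ^ 2) := by ring
    rw [this]
    positivity

lemma charFun_stationaryLaw (hcf : 0 < cf) (hcg : 0 < cg) (hk : k ≠ 0) (hlam : 0 < lam)
    (ξ : Plane) : charFun (stationaryLaw cf cg k lam) ξ =
      Complex.exp (-((ξ.ofLp ⬝ᵥ stationaryCov cf cg k lam *ᵥ ξ.ofLp : ℝ) : ℂ) / 2) := by
  rw [stationaryLaw, charFun_multivariateGaussian (posDef_stationaryCov hcf hcg hk hlam).posSemidef]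
  congr 1
  simp only [inner_zero_right, Complex.ofReal_zero, zero_mul, zero_sub]
  ring

/-- The covariance of the noise accumulated up to time `t`. -/
noncomputable def noiseCov (cf cg k lam t : ℝ) : Matrix (Fin 2) (Fin 2) ℝ :=
  stationaryCov cf cg k lam - (dualFlow (driftMatrix cf cg k lam) t)ᵀ * stationaryCov cf cg k lam *
    dualFlow (driftMatrix cf cg k lam) t

lemma dotProduct_conj_mulVec (M C : Matrix (Fin 2) (Fin 2) ℝ) (x : Fin 2 → ℝ) :
    x ⬝ᵥ (Mᵀ * C * M) *ᵥ x = (M *ᵥ x) ⬝ᵥ C *ᵥ (M *ᵥ x) := by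
  rw [Matrix.mul_assoc, ← Matrix.mulVec_mulVec, ← Matrix.mulVec_mulVec,
    Matrix.dotProduct_mulVec x, Matrix.vecMul_transpose]

lemma integral_sq_dualFlow_eq_noiseCov (hcf : 0 < cf) (hcg : 0 < cg) (hlam : 0 < lam)
    (ξ : Fin 2 → ℝ) (t : ℝ) :
    ∫ s in (0 : ℝ)..t, ((dualFlow (driftMatrix cf cg k lam) s *ᵥ ξ) ⬝ᵥ diffusionVector) ^ 2 =
      ξ ⬝ᵥ noiseCov cf cg k lam t *ᵥ ξ := by
  rw [integral_sq_dualFlow (lyapunov_stationaryCov hcf hcg hlam), noiseCov, Matrix.sub_mulVec,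
    dotProduct_sub, dotProduct_conj_mulVec]

lemma posDef_noiseCov (hcf : 0 < cf) (hcg : 0 < cg) (hk : k ≠ 0) (hlam : 0 < lam) {t : ℝ}
    (ht : 0 < t) : (noiseCov cf cg k lam t).PosDef := by
  have hS := (posDef_stationaryCov hcf hcg hk hlam).1
  refine .of_dotProduct_mulVec_pos (hS.sub ?_) fun ξ hξ => ?_
  · simpa using Matrix.isHermitian_conjTranspose_mul_mul
      (dualFlow (driftMatrix cf cg k lam) t) hS
  · rw [star_trivial, ← integral_sq_dualFlow_eq_noiseCov hcf hcg hlam]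
    exact integral_sq_dualFlow_pos hk hlam hξ ht

lemma posSemidef_noiseCov (hcf : 0 < cf) (hcg : 0 < cg) (hk : k ≠ 0) (hlam : 0 < lam) {t : ℝ}
    (ht : 0 ≤ t) : (noiseCov cf cg k lam t).PosSemidef := by
  rcases ht.eq_or_lt with rfl | ht
  · simpa [noiseCov, dualFlow_zero] using Matrix.PosSemidef.zero
  · exact (posDef_noiseCov hcf hcg hk hlam ht).posSemidef

lemma tendsto_dualFlow_matrix (hcf : 0 < cf) (hcg : 0 < cg) (hlam : 0 < lam) :
    Tendsto (fun t : ℝ≥0 => dualFlow (driftMatrix cf cg k lam) t) atTop (𝓝 0) := by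
  refine tendsto_pi_nhds.2 fun i => tendsto_pi_nhds.2 fun j => ?_
  have h := (tendsto_dualFlow (k := k) hcf hcg hlam (Pi.single j 1) i).comp
    (NNReal.tendsto_coe_atTop.2 tendsto_id)
  simpa [Function.comp_def] using h

variable {Ω : Type*} [MeasurableSpace Ω] {P : Measure Ω} {W : ℝ≥0 → Ω → ℝ} {Z : ℝ≥0 → Ω → Plane}

lemma SolvesLinear.isProbabilityMeasure {A : Matrix (Fin 2) (Fin 2) ℝ} {B : Fin 2 → ℝ}
    (h : SolvesLinear A B P W Z) : IsProbabilityMeasure P :=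
  (h.brownian.hasLaw_eval 0).isProbabilityMeasure

lemma SolvesLinear.isProbabilityMeasure_map {A : Matrix (Fin 2) (Fin 2) ℝ} {B : Fin 2 → ℝ}
    (h : SolvesLinear A B P W Z) (t : ℝ≥0) : IsProbabilityMeasure (P.map (Z t)) :=
  have := h.isProbabilityMeasure
  Measure.isProbabilityMeasure_map (h.aemeasurable t)

lemma SolvesLinear.charFun_map_eq_noiseCov (hcf : 0 < cf) (hcg : 0 < cg) (hlam : 0 < lam)
    (h : SolvesLinear (driftMatrix cf cg k lam) diffusionVector P W Z) (t : ℝ≥0) (ξ : Plane) :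
    charFun (P.map (Z t)) ξ = charFun (P.map (Z 0))
        (WithLp.toLp 2 (dualFlow (driftMatrix cf cg k lam) t *ᵥ ξ.ofLp)) *
      Complex.exp (-((ξ.ofLp ⬝ᵥ noiseCov cf cg k lam t *ᵥ ξ.ofLp : ℝ) : ℂ) / 2) := by
  rw [h.charFun_map, integral_sq_dualFlow_eq_noiseCov hcf hcg hlam]

lemma SolvesLinear.exists_smooth_density (hcf : 0 < cf) (hcg : 0 < cg) (hk : k ≠ 0)
    (hlam : 0 < lam) (h : SolvesLinear (driftMatrix cf cg k lam) diffusionVector P W Z)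
    {t : ℝ≥0} (ht : 0 < t) :
    ∃ ρ : Plane → ℝ, ContDiff ℝ ((⊤ : ℕ∞) : WithTop ℕ∞) ρ ∧ (∀ z, 0 ≤ ρ z) ∧
      P.map (Z t) = volume.withDensity fun z => ENNReal.ofReal (ρ z) := by
  have := h.isProbabilityMeasure_map
  obtain ⟨ε, hε, hps⟩ := exists_posSemidef_sub_smul_one
    (posDef_noiseCov hcf hcg hk hlam (t := t) (by exact_mod_cast ht))
  set M := dualFlow (driftMatrix cf cg k lam) t with hM
  have hcont := continuous_affineMap 0 Mᵀ
  have : IsProbabilityMeasure ((P.map (Z 0)).map (affineMap 0 Mᵀ)) :=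
    Measure.isProbabilityMeasure_map hcont.measurable.aemeasurable
  refine PrimalDual.exists_smooth_density (ν := (P.map (Z 0)).map (affineMap 0 Mᵀ) ∗
    multivariateGaussian 0 (noiseCov cf cg k lam t - ε • 1)) hε fun ξ => ?_
  have hpush : charFun ((P.map (Z 0)).map (affineMap 0 Mᵀ)) ξ =
      charFun (P.map (Z 0)) (WithLp.toLp 2 (M *ᵥ ξ.ofLp)) := by
    rw [charFun_apply, charFun_apply, integral_map hcont.measurable.aemeasurable (by fun_prop)]
    refine integral_congr_ae (ae_of_all _ fun x => ?_)
    simp only [affineMap, zero_add, inner_eq_dotProduct, Matrix.ofLp_toEuclideanCLM]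
    rw [Matrix.dotProduct_mulVec, Matrix.vecMul_transpose]
  rw [h.charFun_map_eq_noiseCov hcf hcg hlam, charFun_conv, hpush,
    charFun_multivariateGaussian hps, mul_assoc, ← Complex.exp_add]
  congr 2
  have hn : ‖ξ‖ ^ 2 = ξ.ofLp ⬝ᵥ ξ.ofLp := by
    rw [← real_inner_self_eq_norm_sq, inner_eq_dotProduct]
  rw [hn, Matrix.sub_mulVec, dotProduct_sub, Matrix.smul_mulVec, Matrix.one_mulVec,
    dotProduct_smul, smul_eq_mul]
  push_cast
  simp only [inner_zero_right, Complex.ofReal_zero]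
  ring

lemma SolvesLinear.map_eq_multivariateGaussian (hcf : 0 < cf) (hcg : 0 < cg) (hk : k ≠ 0)
    (hlam : 0 < lam) (h : SolvesLinear (driftMatrix cf cg k lam) diffusionVector P W Z)
    {m : Plane} {C : Matrix (Fin 2) (Fin 2) ℝ} (hC : C.PosSemidef)
    (h0 : P.map (Z 0) = multivariateGaussian m C) (t : ℝ≥0) :
    ((dualFlow (driftMatrix cf cg k lam) t)ᵀ * C * dualFlow (driftMatrix cf cg k lam) t
      ).PosSemidef ∧
    P.map (Z t) = multivariateGaussian
      (WithLp.toLp 2 ((dualFlow (driftMatrix cf cg k lam) t)ᵀ *ᵥ m.ofLp))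
      ((dualFlow (driftMatrix cf cg k lam) t)ᵀ * C * dualFlow (driftMatrix cf cg k lam) t +
        noiseCov cf cg k lam t) := by
  have := h.isProbabilityMeasure_map
  have hps : ((dualFlow (driftMatrix cf cg k lam) t)ᵀ * C *
      dualFlow (driftMatrix cf cg k lam) t).PosSemidef := by
    simpa using hC.conjTranspose_mul_mul_same (dualFlow (driftMatrix cf cg k lam) t)
  refine ⟨hps, Measure.ext_of_charFun (funext fun ξ => ?_)⟩
  rw [h.charFun_map_eq_noiseCov hcf hcg hlam, h0, charFun_multivariateGaussian hC,
    charFun_multivariateGaussian (hps.add (posSemidef_noiseCov hcf hcg hk hlam t.coe_nonneg)),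
    ← Complex.exp_add, Matrix.add_mulVec, dotProduct_add, dotProduct_conj_mulVec]
  congr 1
  simp only [inner_eq_dotProduct]
  rw [Matrix.mulVec_transpose, ← Matrix.dotProduct_mulVec]
  push_cast
  ring

lemma SolvesLinear.gaussian_initial (hcf : 0 < cf) (hcg : 0 < cg) (hk : k ≠ 0)
    (hlam : 0 < lam) (h : SolvesLinear (driftMatrix cf cg k lam) diffusionVector P W Z)
    (h0 : IsGaussian (P.map (Z 0))) :
    (∀ t : ℝ≥0, 0 < t → ∃ (m : Plane) (S : Matrix (Fin 2) (Fin 2) ℝ),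
      S.PosDef ∧ P.map (Z t) = multivariateGaussian m S) ∧
    TendstoWeakly (fun t : ℝ≥0 => P.map (Z t)) atTop (stationaryLaw cf cg k lam) ∧
    Tendsto (fun t : ℝ≥0 => wasserstein (P.map (Z t)) (stationaryLaw cf cg k lam))
      atTop (𝓝 0) := by
  obtain ⟨m, C, hC, hmC⟩ := exists_eq_multivariateGaussian (P.map (Z 0))
  have hlaw := h.map_eq_multivariateGaussian hcf hcg hk hlam hC hmC
  have hS := posDef_stationaryCov hcf hcg hk hlam
  refine ⟨fun t ht => ⟨_, _, ?_, (hlaw t).2⟩, ?_⟩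
  · exact (posDef_noiseCov hcf hcg hk hlam (by exact_mod_cast ht)).posSemidef_add (hlaw t).1
  have hM := tendsto_dualFlow_matrix (k := k) hcf hcg hlam
  have hconj : ∀ D : Matrix (Fin 2) (Fin 2) ℝ, Tendsto (fun t : ℝ≥0 =>
      (dualFlow (driftMatrix cf cg k lam) t)ᵀ * D * dualFlow (driftMatrix cf cg k lam) t)
      atTop (𝓝 0) := fun D => by
    have hc : Continuous fun M : Matrix (Fin 2) (Fin 2) ℝ => Mᵀ * D * M := by fun_prop
    simpa [Function.comp_def] using (hc.tendsto 0).comp hM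
  refine tendsto_multivariateGaussian (Eventually.of_forall fun t => ⟨?_, (hlaw t).2⟩)
    hS.posSemidef hS.diag_pos ?_ ?_
  · exact (hlaw t).1.add (posSemidef_noiseCov hcf hcg hk hlam t.coe_nonneg)
  · have hc : Continuous fun M : Matrix (Fin 2) (Fin 2) ℝ =>
        (WithLp.toLp 2 (Mᵀ *ᵥ m.ofLp) : Plane) :=
      (PiLp.continuous_toLp 2 _).comp (by fun_prop)
    have h0 := (hc.tendsto 0).comp hM
    rw [Matrix.transpose_zero, Matrix.zero_mulVec, WithLp.toLp_zero] at h0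
    exact h0
  · simpa [noiseCov] using (hconj C).add ((hconj (stationaryCov cf cg k lam)).const_sub
      (stationaryCov cf cg k lam))

lemma SolvesLinear.map_eq_stationaryLaw_iff (hcf : 0 < cf) (hcg : 0 < cg) (hk : k ≠ 0)
    (hlam : 0 < lam) (h : SolvesLinear (driftMatrix cf cg k lam) diffusionVector P W Z) :
    P.map (Z 0) = stationaryLaw cf cg k lam ↔ ∀ t : ℝ≥0, P.map (Z t) = P.map (Z 0) := by
  have := h.isProbabilityMeasure_map
  have hS := posDef_stationaryCov hcf hcg hk hlam
  constructor
  · intro h0 t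
    rw [(h.map_eq_multivariateGaussian hcf hcg hk hlam hS.posSemidef h0 t).2, h0, stationaryLaw,
      noiseCov, add_sub_cancel]
    simp
  · intro hst
    have : IsProbabilityMeasure (stationaryLaw cf cg k lam) := by
      unfold stationaryLaw; infer_instance
    refine Measure.ext_of_charFun (funext fun ξ => ?_)
    rw [charFun_stationaryLaw hcf hcg hk hlam]
    have hM := tendsto_dualFlow_matrix (k := k) hcf hcg hlam
    have hc : Continuous fun M : Matrix (Fin 2) (Fin 2) ℝ => charFun (P.map (Z 0))
        (WithLp.toLp 2 (M *ᵥ ξ.ofLp)) * Complex.exp (-((ξ.ofLp ⬝ᵥ (stationaryCov cf cg k lam -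
          Mᵀ * stationaryCov cf cg k lam * M) *ᵥ ξ.ofLp : ℝ) : ℂ) / 2) := by
      refine Continuous.mul ?_ ?_
      · exact continuous_charFun.comp ((PiLp.continuous_toLp 2 _).comp (by fun_prop))
      · fun_prop
    have hlim := (hc.tendsto 0).comp hM
    simp only [Matrix.zero_mulVec, WithLp.toLp_zero, charFun_zero, probReal_univ,
      Complex.ofReal_one, one_mul, Matrix.mul_zero, sub_zero] at hlim
    refine tendsto_nhds_unique (tendsto_const_nhds.congr fun t => ?_) hlim
    have h1 := h.charFun_map_eq_noiseCov hcf hcg hlam t ξ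
    rw [hst t] at h1
    exact h1

end Stationary

section Target

variable {cf cg k : ℝ}

/-- The variance of the target distribution. -/
noncomputable def targetVar (cf cg k : ℝ) : ℝ := cf * cg / (cf + k ^ 2 * cg)

lemma targetVar_pos (hcf : 0 < cf) (hcg : 0 < cg) : 0 < targetVar cf cg k := by
  unfold targetVar
  positivity

lemma target_eq_gaussianReal (hcf : 0 < cf) (hcg : 0 < cg) :
    target (quadPotential cf) (quadPotential cg) k =
      gaussianReal 0 (targetVar cf cg k).toNNReal := by
  have hv := targetVar_pos (k := k) hcf hcg
  set v := targetVar cf cg k with hvdef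
  have hpi := Real.pi_pos
  have hexp : ∀ x : ℝ, -fullPotential (quadPotential cf) (quadPotential cg) k x =
      -(2 * v)⁻¹ * x ^ 2 := fun x => by
    rw [fullPotential_quadPotential hcf hcg, hvdef, targetVar]
    have : cf + k ^ 2 * cg ≠ 0 := by positivity
    field_simp
    ring
  rw [target, Measure.tilted, gaussianReal_of_var_ne_zero _ (by simpa using hv)]
  congr 1
  funext x
  rw [gaussianPDF, gaussianPDFReal]
  congr 1
  simp_rw [hexp]
  rw [integral_gaussian, Real.coe_toNNReal _ hv.le, div_eq_inv_mul]
  congr 2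
  · congr 1
    field_simp
  · field_simp
    ring

/-- The covariance of the lifted target distribution. -/
noncomputable def liftedCov (cf cg k : ℝ) : Matrix (Fin 2) (Fin 2) ℝ :=
  targetVar cf cg k • Matrix.vecMulVec ![1, cf⁻¹ * k] ![1, cf⁻¹ * k]

lemma posSemidef_liftedCov (hcf : 0 < cf) (hcg : 0 < cg) : (liftedCov cf cg k).PosSemidef := by
  have := (Matrix.posSemidef_vecMulVec_self_star ![1, cf⁻¹ * k]).smul
    (targetVar_pos (k := k) hcf hcg).le
  simpa [liftedCov] using this

lemma measurable_lift : Measurable fun x : ℝ => (!₂[x, deriv (quadPotential cf) (k * x)] : Plane) := by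
  simp_rw [deriv_quadPotential]
  refine (PiLp.continuous_toLp 2 _).measurable.comp (measurable_pi_iff.2 fun i => ?_)
  fin_cases i
  · exact measurable_id
  · exact (measurable_const_mul k).const_mul cf⁻¹

lemma liftedTarget_eq (hcf : 0 < cf) (hcg : 0 < cg) :
    liftedTarget (quadPotential cf) (quadPotential cg) k =
      multivariateGaussian 0 (liftedCov cf cg k) := by
  have hv := targetVar_pos (k := k) hcf hcg
  have hm := measurable_lift (cf := cf) (k := k)
  rw [liftedTarget, target_eq_gaussianReal hcf hcg]
  have := Measure.isProbabilityMeasure_map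
    (μ := gaussianReal 0 (targetVar cf cg k).toNNReal) hm.aemeasurable
  refine Measure.ext_of_charFun (funext fun ξ => ?_)
  rw [charFun_multivariateGaussian (posSemidef_liftedCov hcf hcg), charFun_apply,
    integral_map hm.aemeasurable (by fun_prop)]
  have hin : ∀ x : ℝ, (inner ℝ (!₂[x, deriv (quadPotential cf) (k * x)] : Plane) ξ : ℝ) =
      (ξ 0 + cf⁻¹ * k * ξ 1) * x := fun x => by
    rw [inner_eq_dotProduct, deriv_quadPotential]
    simp [dotProduct, Fin.sum_univ_two]
    ring
  simp_rw [hin, Complex.ofReal_mul]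
  have hg := charFun_gaussianReal (μ := 0) (v := (targetVar cf cg k).toNNReal)
    (ξ 0 + cf⁻¹ * k * ξ 1)
  rw [charFun_apply_real] at hg
  rw [hg, Real.coe_toNNReal _ hv.le]
  congr 1
  simp [liftedCov, dotProduct, Fin.sum_univ_two]
  ring

lemma map_liftedTarget : (liftedTarget (quadPotential cf) (quadPotential cg) k).map (fun z => z 0) =
    target (quadPotential cf) (quadPotential cg) k := by
  rw [liftedTarget, Measure.map_map (by fun_prop) measurable_lift]
  convert Measure.map_id
  rfl

lemma map_stationaryLaw_ne_target {lam : ℝ} (hcf : 0 < cf) (hcg : 0 < cg) (hk : k ≠ 0)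
    (hlam : 0 < lam) : (stationaryLaw cf cg k lam).map (fun z => z 0) ≠
      target (quadPotential cf) (quadPotential cg) k := by
  have hS := posDef_stationaryCov hcf hcg hk hlam
  rw [target_eq_gaussianReal hcf hcg, stationaryLaw,
    (measurePreserving_eval_multivariateGaussian hS.posSemidef (i := 0)).map_eq]
  intro h
  have hvar := (gaussianReal_ext_iff.1 h).2
  rw [Real.toNNReal_eq_toNNReal_iff hS.diag_pos.le (targetVar_pos hcf hcg).le] at hvar
  have hD : cf + k ^ 2 * cg ≠ 0 := by positivity
  have hD' : 1 + lam * cf * cg ≠ 0 := by positivity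
  simp [stationaryCov, targetVar] at hvar
  field_simp at hvar
  have h2 : k ^ 2 * cg = 0 := by linarith
  have : 0 < k ^ 2 * cg := by positivity
  linarith

lemma tendsto_stationaryCov (hcf : 0 < cf) (hcg : 0 < cg) :
    Tendsto (fun lam => stationaryCov cf cg k lam) atTop (𝓝 (liftedCov cf cg k)) := by
  have hD : 0 < cf + k ^ 2 * cg := by positivity
  have hr : Tendsto (fun lam : ℝ => (1 + lam * cf * cg)⁻¹) atTop (𝓝 0) := by
    refine tendsto_inv_atTop_zero.comp (tendsto_atTop_add_const_left _ _ ?_)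
    exact (tendsto_id.atTop_mul_const hcf).atTop_mul_const hcg
  set R : Matrix (Fin 2) (Fin 2) ℝ := !![cg - targetVar cf cg k, -(k * cg / (cf + k ^ 2 * cg));
    -(k * cg / (cf + k ^ 2 * cg)), -(k ^ 2 * cg / (cf * (cf + k ^ 2 * cg)))] with hR
  have key : ∀ᶠ lam : ℝ in atTop, liftedCov cf cg k + (1 + lam * cf * cg)⁻¹ • R =
      stationaryCov cf cg k lam := by
    filter_upwards [eventually_gt_atTop 0] with lam hlam
    have hD' : 1 + lam * cf * cg ≠ 0 := by positivity
    ext i j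
    fin_cases i <;> fin_cases j <;>
      simp [liftedCov, stationaryCov, targetVar, hR] <;> field_simp <;> ring
  refine Tendsto.congr' key ?_
  simpa using (hr.smul_const R).const_add (liftedCov cf cg k)

end Target

end PrimalDual

open PrimalDual in
theorem mainTheorem7 (cf cg k : ℝ) (hcf : 0 < cf) (hcg : 0 < cg) (hk : k ≠ 0) :
    -- the potentials
    (∀ x, fullPotential (quadPotential cf) (quadPotential cg) k x =
      (k ^ 2 * cg + cf) / (2 * cf * cg) * x ^ 2) ∧
    (∀ y, convexConjugate (fun x => (quadPotential cf x : EReal)) y =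
      ((cf / 2 * y ^ 2 : ℝ) : EReal)) ∧
    (∀ lam : ℝ, 0 < lam →
      -- the primal-dual diffusion is the linear equation
      (∀ (Ω : Type*) [MeasurableSpace Ω] (P : Measure Ω) (W : ℝ≥0 → Ω → ℝ) (Z : ℝ≥0 → Ω → Plane),
        SolvesPrimalDual (fun x => (quadPotential cf x : EReal))
            (fun x => (quadPotential cg x : EReal)) k lam P W Z ↔
          SolvesLinear (driftMatrix cf cg k lam) diffusionVector P W Z) ∧
      (∀ (Ω : Type*) [MeasurableSpace Ω] (P : Measure Ω) (W : ℝ≥0 → Ω → ℝ) (Z : ℝ≥0 → Ω → Plane),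
        SolvesLinear (driftMatrix cf cg k lam) diffusionVector P W Z →
          -- smooth density for positive times, for every initial law
          (∀ t : ℝ≥0, 0 < t → ∃ ρ : Plane → ℝ, ContDiff ℝ ((⊤ : ℕ∞) : WithTop ℕ∞) ρ ∧ (∀ z, 0 ≤ ρ z) ∧
            P.map (Z t) = volume.withDensity fun z => ENNReal.ofReal (ρ z)) ∧
          -- Gaussian initial laws, possibly degenerate
          (IsGaussian (P.map (Z 0)) →
            (∀ t : ℝ≥0, 0 < t → ∃ (m : Plane) (S : Matrix (Fin 2) (Fin 2) ℝ),
              S.PosDef ∧ P.map (Z t) = multivariateGaussian m S) ∧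
            TendstoWeakly (fun t : ℝ≥0 => P.map (Z t)) atTop (stationaryLaw cf cg k lam) ∧
            Tendsto (fun t : ℝ≥0 => wasserstein (P.map (Z t)) (stationaryLaw cf cg k lam))
              atTop (𝓝 0)) ∧
          -- the limit is the one and only stationary law
          (P.map (Z 0) = stationaryLaw cf cg k lam ↔ ∀ t : ℝ≥0, P.map (Z t) = P.map (Z 0))) ∧
      (stationaryCov cf cg k lam).PosDef ∧
      -- its primal marginal is not the target
      (stationaryLaw cf cg k lam).map (fun z => z 0) ≠
        target (quadPotential cf) (quadPotential cg) k) ∧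
    -- the limit of infinite weight
    TendstoWeakly (fun lam : ℝ => stationaryLaw cf cg k lam) atTop
      (liftedTarget (quadPotential cf) (quadPotential cg) k) ∧
    Tendsto (fun lam : ℝ => wasserstein (stationaryLaw cf cg k lam)
      (liftedTarget (quadPotential cf) (quadPotential cg) k)) atTop (𝓝 0) ∧
    (∃ S : Matrix (Fin 2) (Fin 2) ℝ, S.PosSemidef ∧ S.det = 0 ∧
      liftedTarget (quadPotential cf) (quadPotential cg) k = multivariateGaussian 0 S) ∧
    (liftedTarget (quadPotential cf) (quadPotential cg) k).map (fun z => z 0) =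
      target (quadPotential cf) (quadPotential cg) k := by
  have hv := targetVar_pos (k := k) hcf hcg
  have h00 : 0 < liftedCov cf cg k 0 0 := by simpa [liftedCov] using hv
  have hlim := tendsto_multivariateGaussian (l := atTop) (m := fun _ : ℝ => (0 : Plane))
    (μ := fun lam => stationaryLaw cf cg k lam) (S := fun lam => stationaryCov cf cg k lam)
    ((eventually_gt_atTop 0).mono fun lam hlam =>
      ⟨(posDef_stationaryCov hcf hcg hk hlam).posSemidef, rfl⟩)
    (posSemidef_liftedCov hcf hcg) h00 tendsto_const_nhds (tendsto_stationaryCov hcf hcg)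
  rw [← liftedTarget_eq hcf hcg] at hlim
  refine ⟨fullPotential_quadPotential hcf hcg k, convexConjugate_quadPotential hcf,
    fun lam hlam => ⟨fun Ω _ P W Z => solvesPrimalDual_iff_solvesLinear hcf hcg,
      fun Ω _ P W Z h => ⟨fun t ht => h.exists_smooth_density hcf hcg hk hlam ht,
        h.gaussian_initial hcf hcg hk hlam, h.map_eq_stationaryLaw_iff hcf hcg hk hlam⟩,
      posDef_stationaryCov hcf hcg hk hlam, map_stationaryLaw_ne_target hcf hcg hk hlam⟩,
    hlim.1, hlim.2, ⟨liftedCov cf cg k, posSemidef_liftedCov hcf hcg, ?_, liftedTarget_eq hcf hcg⟩,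
    map_liftedTarget⟩
  rw [liftedCov, Matrix.det_smul, Matrix.det_vecMulVec, mul_zero]
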